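/- Let $d\ge 1$ be an integer and let $\mathbf F(a,b;c;z)={}_2F_1(a,b;c;z)/\Gamma(c)$ be the regularized hypergeometric function, i.e. the holomorphic continuation of $\sum_{n\ge0}\frac{(a)_n(b)_n}{\Gamma(c+n)\,n!}z^n$ from the unit disc to the cut plane $\mathbb C\setminus[1,\infty)$. For $\lambda\in\mathbb C$ let $$G^{(d)}_\lambda(\sigma)=\frac{\Gamma(\frac d2+i\lambda)\,\Gamma(\frac d2-i\lambda)}{(4\pi)^{\frac{d+1}{2}}}\,\mathbf F\!\left(\tfrac d2+i\lambda,\tfrac d2-i\lambda;\tfrac{d+1}{2};\tfrac{1+\sigma}{2}\right)$$ be the free scalar propagator of de Sitter space $\mathrm{dS}_{d+1}$ (of radius $1$) in the Bunch–Davies vacuum. Suppose that $\lambda$ is in the principal series ($\lambda\in\mathbb R$) or in the complementary series ($i\lambda\in(-\frac d2,\frac d2)$). Then $G^{(d)}_\lambda$ is holomorphic on $\{\sigma\in\mathbb C:\frac{1+\sigma}{2}\notin[1,\infty)\}=\mathbb C\setminus[1,\infty)$, and there are real numbers $B_n(d,\lambda)\ge 0$, $n\ge0$, such that $$G^{(d)}_\lambda(\sigma)=\sum_{n=0}^\infty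 B_n(d,\lambda)\,\rho^n$$ with a convergent series for all complex $\sigma,\rho$ with $|\rho|<1$ and $\frac{1+\sigma}{2}=\frac{4\rho}{(1+\rho)^2}$. If $\lambda$ is in the complementary series, then moreover $B_n(d,\lambda)>0$ for all $n\ge0$. -/

import Mathlib

namespace DeSitter

/-- The cut plane `ℂ \ [1, +∞)`. -/
def cutPlane : Set ℂ := (Complex.ofReal '' Set.Ici (1 : ℝ))ᶜ

/-- `F` is a holomorphic function on the cut plane which on the unit disc is the sum of the
regularized Gauss series `∑ (a)_n (b)_n / (Γ(c + n) n!) z ^ n`. -/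
def IsHypergeometricContinuation (a b c : ℂ) (F : ℂ → ℂ) : Prop :=
  DifferentiableOn ℂ F cutPlane ∧
    ∀ z : ℂ, ‖z‖ < 1 → F z = Complex.regularizedGaussHGFun a b c z

open Classical in
/-- The regularized hypergeometric function `𝐅(a, b; c; z) = ₂F₁(a, b; c; z) / Γ(c)` on the cut
plane, i.e. the holomorphic continuation of the regularized Gauss series from the unit disc to
`ℂ \ [1, +∞)` (unique there by `IsHypergeometricContinuation.eqOn`). The `else` branch only makes
the definition total; in either branch the value for `‖z‖ < 1` is the sum of the Gauss series. -/
noncomputable def regularizedF (a b c : ℂ) : ℂ → ℂ :=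
  if h : ∃ F : ℂ → ℂ, IsHypergeometricContinuation a b c F then h.choose
  else Complex.regularizedGaussHGFun a b c

theorem mem_cutPlane_iff {z : ℂ} : z ∈ cutPlane ↔ 1 - z ∈ Complex.slitPlane := by
  rw [Complex.mem_slitPlane_iff_not_le_zero, cutPlane, Set.mem_compl_iff, not_iff_not]
  constructor
  · rintro ⟨x, hx, rfl⟩
    rw [Set.mem_Ici] at hx
    rw [Complex.le_def]
    simp [hx]
  · intro h
    rw [Complex.le_def] at h
    simp only [Complex.sub_re, Complex.one_re, Complex.zero_re, Complex.sub_im, Complex.one_im,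
      Complex.zero_im] at h
    refine ⟨z.re, ?_, ?_⟩
    · rw [Set.mem_Ici]; linarith [h.1]
    · apply Complex.ext
      · simp
      · simp only [Complex.ofReal_im]; linarith [h.2]

theorem IsHypergeometricContinuation.eqOn {a b c : ℂ} {F F' : ℂ → ℂ}
    (h : IsHypergeometricContinuation a b c F) (h' : IsHypergeometricContinuation a b c F') :
    Set.EqOn F F' cutPlane := by
  have hpre : cutPlane = (fun z : ℂ => 1 - z) ⁻¹' Complex.slitPlane := by
    ext z; exact mem_cutPlane_iff
  have hopen : IsOpen cutPlane := by
    rw [hpre]; exact Complex.isOpen_slitPlane.preimage (by fun_prop)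
  have hconn : IsPreconnected cutPlane := by
    have himg : cutPlane = (fun z : ℂ => 1 - z) '' Complex.slitPlane := by
      rw [hpre]
      ext z
      constructor
      · intro hz; exact ⟨1 - z, hz, by simp⟩
      · rintro ⟨w, hw, rfl⟩; simpa using hw
    rw [himg]
    have hs : IsPreconnected Complex.slitPlane :=
      (Complex.starConvex_one_slitPlane.isPathConnected
        Complex.one_mem_slitPlane).isConnected.isPreconnected
    exact hs.image _ (by fun_prop)
  refine (h.1.analyticOnNhd hopen).eqOn_of_preconnected_of_eventuallyEq (h'.1.analyticOnNhd hopen)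
    hconn (z₀ := 0) (mem_cutPlane_iff.2 (by simp)) ?_
  filter_upwards [Metric.ball_mem_nhds (0 : ℂ) one_pos] with z hz
  rw [mem_ball_zero_iff] at hz
  rw [h.2 z hz, h'.2 z hz]

theorem regularizedF_eq_of_norm_lt_one (a b c : ℂ) {z : ℂ} (hz : ‖z‖ < 1) :
    regularizedF a b c z = Complex.regularizedGaussHGFun a b c z := by
  unfold regularizedF
  split_ifs with h
  · exact h.choose_spec.2 z hz
  · rfl

/-- The Bunch–Davies free propagator of `dS_{d+1}` of unit radius and mass `m² = d²/4 + lam²`, as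
a function of the two-point invariant `σ`. -/
noncomputable def freePropagator (d : ℕ) (lam σ : ℂ) : ℂ :=
  Complex.Gamma (d / 2 + Complex.I * lam) * Complex.Gamma (d / 2 - Complex.I * lam)
      / (((4 * Real.pi) ^ (((d : ℝ) + 1) / 2) : ℝ) : ℂ)
    * regularizedF (d / 2 + Complex.I * lam) (d / 2 - Complex.I * lam) ((d + 1) / 2)
        ((1 + σ) / 2)

/-- Principal series: `λ ∈ ℝ`. -/
def IsPrincipal (lam : ℂ) : Prop := ∃ x : ℝ, lam = x

/-- Complementary series: `iλ ∈ (-d/2, d/2)`. -/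
def IsComplementary (d : ℕ) (lam : ℂ) : Prop :=
  ∃ x : ℝ, x ∈ Set.Ioo (-(d : ℝ) / 2) ((d : ℝ) / 2) ∧ Complex.I * lam = x

end DeSitter

/-!
Write `ρ` for the radial variable, `z = 4 ρ / (1 + ρ) ^ 2`. Substituting Möbius maps of `(0, 1)`
into Euler's integral for `𝐅` gives it several forms in `ρ`.

In the principal series one of them is `(1 + ρ) ^ d (1 - ρ) ^ (-(d - c))`, `c = (d + 1) / 2`, times
a Beta average over `s` of the kernel `g(t) = (1 - t) ^ (a - c) (1 + t) ^ (-a)` at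
`t = (1 - 2 s) ρ`. The moments of `1 - 2 s` for that Beta weight are, by the same change of
variables, proportional to the conjugates of the Taylor coefficients of `g`, so the average has
Taylor coefficients proportional to `|g_n| ^ 2`.

In the complementary series the derivative in `ρ` is a Beta average of the kernels
`(1 + ρ) ^ (2 b - 1) (1 - ρ) ^ (-(2 b + 1 + 2 κ)) (1 + 2 x ρ + ρ ^ 2) ^ κ` with `|x| ≤ 1`. Their
logarithmic derivatives have nonnegative Taylor coefficients and a positive constant term, hence
all their own Taylor coefficients are positive.

Each identity is checked for `0 < ρ < 1` and extended by the identity theorem.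
-/

namespace DeSitter

open MeasureTheory Metric Filter Topology
open scoped ComplexOrder ComplexConjugate

section DominatedFamilies

variable {α E : Type*} [MeasurableSpace α] [NormedAddCommGroup E] [NormedSpace ℂ E]
  {μ : Measure α} {F : α → ℂ → E} {U : Set ℂ} {z : ℂ}

/-- A family of functions `F s`, holomorphic on an open set `U` for almost every `s`, which locally
on `U` is bounded by an integrable function of `s` alone. This is the class of families that can be
differentiated any number of times under the integral sign. -/
structure IsDominatedHolomorphic (μ : Measure α) (F : α → ℂ → E) (U : Set ℂ) : Prop where
  isOpen : IsOpen U
  aestronglyMeasurable : ∀ z ∈ U, AEStronglyMeasurable (F · z) μ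
  differentiableOn : ∀ᵐ s ∂μ, DifferentiableOn ℂ (F s) U
  exists_bound : ∀ z ∈ U, ∃ V ∈ 𝓝 z, ∃ g : α → ℝ, Integrable g μ ∧
    ∀ᵐ s ∂μ, ∀ w ∈ V, ‖F s w‖ ≤ g s

namespace IsDominatedHolomorphic

theorem integrable (hF : IsDominatedHolomorphic μ F U) (hz : z ∈ U) : Integrable (F · z) μ := by
  obtain ⟨V, hV, g, hg, hFg⟩ := hF.exists_bound z hz
  exact hg.mono' (hF.aestronglyMeasurable z hz) (hFg.mono fun s hs => hs z (mem_of_mem_nhds hV))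

theorem aestronglyMeasurable_deriv (hF : IsDominatedHolomorphic μ F U) (hz : z ∈ U) :
    AEStronglyMeasurable (fun s => deriv (F s) z) μ := by
  obtain ⟨ε, hε, hεU⟩ := Metric.isOpen_iff.1 hF.isOpen z hz
  obtain ⟨u, -, hu, hu0⟩ := exists_seq_strictAnti_tendsto' hε
  have hmem (n : ℕ) : z + u n ∈ U :=
    hεU (by simpa [abs_of_pos (hu n).1] using (hu n).2)
  have hlim : Tendsto (fun n => z + (u n : ℂ)) atTop (𝓝[≠] z) := by
    refine tendsto_nhdsWithin_iff.2 ⟨?_, Eventually.of_forall fun n => ?_⟩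
    · simpa using ((Complex.continuous_ofReal.tendsto 0).comp hu0).const_add z
    · simpa using (hu n).1.ne'
  refine aestronglyMeasurable_of_tendsto_ae atTop
    (f := fun n s => slope (F s) z (z + u n)) (fun n => ?_) ?_
  · simp only [slope, vsub_eq_sub]
    exact ((hF.aestronglyMeasurable _ (hmem n)).sub (hF.aestronglyMeasurable z hz)).const_smul _
  · filter_upwards [hF.differentiableOn] with s hs
    exact (hs.differentiableAt (hF.isOpen.mem_nhds hz)).hasDerivAt.tendsto_slope.comp hlim

variable [CompleteSpace E]

protected theorem deriv (hF : IsDominatedHolomorphic μ F U) :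
    IsDominatedHolomorphic μ (fun s => deriv (F s)) U where
  isOpen := hF.isOpen
  aestronglyMeasurable _ hz := hF.aestronglyMeasurable_deriv hz
  differentiableOn := hF.differentiableOn.mono fun _ hs => hs.deriv hF.isOpen
  exists_bound z hz := by
    obtain ⟨V, hV, g, hg, hFg⟩ := hF.exists_bound z hz
    obtain ⟨ε, hε, hεV⟩ := Metric.mem_nhds_iff.1 (inter_mem hV (hF.isOpen.mem_nhds hz))
    refine ⟨ball z (ε / 2), ball_mem_nhds z (half_pos hε), fun s => g s / (ε / 2),
      hg.div_const _, ?_⟩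
    filter_upwards [hFg, hF.differentiableOn] with s hgs hs w hw
    have hsub : closedBall w (ε / 2) ⊆ V ∩ U :=
      (closedBall_subset_ball' (by linarith [mem_ball.1 hw])).trans hεV
    refine Complex.norm_deriv_le_of_forall_mem_sphere_norm_le (half_pos hε)
      (hs.mono ?_).diffContOnCl fun v hv => hgs v (hsub (sphere_subset_closedBall hv)).1
    exact closure_ball_subset_closedBall.trans fun v hv => (hsub hv).2

theorem iteratedDeriv_family (hF : IsDominatedHolomorphic μ F U) (n : ℕ) :
    IsDominatedHolomorphic μ (fun s => iteratedDeriv n (F s)) U := by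
  induction n with
  | zero => simpa only [iteratedDeriv_zero] using hF
  | succ n ih => simpa only [iteratedDeriv_succ] using ih.deriv

theorem hasDerivAt_integral (hF : IsDominatedHolomorphic μ F U) (hz : z ∈ U) :
    HasDerivAt (fun w => ∫ s, F s w ∂μ) (∫ s, _root_.deriv (F s) z ∂μ) z := by
  obtain ⟨V, hV, g, hg, hFg⟩ := hF.deriv.exists_bound z hz
  have hU := hF.isOpen.mem_nhds hz
  refine (hasDerivAt_integral_of_dominated_loc_of_deriv_le (inter_mem hV hU)
    (eventually_of_mem hU hF.aestronglyMeasurable) (hF.integrable hz)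
    (hF.aestronglyMeasurable_deriv hz) (hFg.mono fun s hs w hw => hs w hw.1) hg ?_).2
  filter_upwards [hF.differentiableOn] with s hs w hw
  exact (hs.differentiableAt (hF.isOpen.mem_nhds hw.2)).hasDerivAt

theorem differentiableOn_integral (hF : IsDominatedHolomorphic μ F U) :
    DifferentiableOn ℂ (fun w => ∫ s, F s w ∂μ) U := fun _ hz =>
  (hF.hasDerivAt_integral hz).differentiableAt.differentiableWithinAt

theorem iteratedDeriv_integral (hF : IsDominatedHolomorphic μ F U) (hz : z ∈ U) (n : ℕ) :
    iteratedDeriv n (fun w => ∫ s, F s w ∂μ) z = ∫ s, iteratedDeriv n (F s) z ∂μ := by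
  induction n generalizing z with
  | zero => simp only [iteratedDeriv_zero]
  | succ n ih =>
    have hloc : iteratedDeriv n (fun w => ∫ s, F s w ∂μ)
        =ᶠ[𝓝 z] fun w => ∫ s, iteratedDeriv n (F s) w ∂μ :=
      eventually_of_mem (hF.isOpen.mem_nhds hz) fun w hw => ih hw
    simp only [iteratedDeriv_succ]
    rw [hloc.deriv_eq, ((hF.iteratedDeriv_family n).hasDerivAt_integral hz).deriv]

end IsDominatedHolomorphic

theorem IsDominatedHolomorphic.of_continuousOn_compact [TopologicalSpace α] [OpensMeasurableSpace α]
    {S K : Set α} {w : α → ℂ} {k : α → ℂ → ℂ} (hU : IsOpen U) (hK : IsCompact K) (hSK : S ⊆ K)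
    (hS : MeasurableSet S) (hw : IntegrableOn w S μ) (hk : ContinuousOn k.uncurry (K ×ˢ U))
    (hd : ∀ s ∈ S, DifferentiableOn ℂ (k s) U) :
    IsDominatedHolomorphic (μ.restrict S) (fun s z => w s * k s z) U where
  isOpen := hU
  aestronglyMeasurable z hz := by
    have hkz : ContinuousOn (k · z) S :=
      hk.comp (continuousOn_id.prodMk continuousOn_const) fun s hs => ⟨hSK hs, hz⟩
    exact hw.aestronglyMeasurable.mul (hkz.aestronglyMeasurable hS)
  differentiableOn := (ae_restrict_mem hS).mono fun s hs => (hd s hs).const_mul (w s)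
  exists_bound z hz := by
    obtain ⟨ε, hε, hεU⟩ := Metric.nhds_basis_closedBall.mem_iff.1 (hU.mem_nhds hz)
    obtain ⟨C, hC⟩ := (hK.prod (isCompact_closedBall z ε)).exists_bound_of_continuousOn
      (hk.mono (Set.prod_mono_right hεU))
    refine ⟨closedBall z ε, closedBall_mem_nhds z hε, fun s => ‖w s‖ * C, hw.norm.mul_const C, ?_⟩
    filter_upwards [ae_restrict_mem hS] with s hs v hv
    rw [norm_mul]
    exact mul_le_mul_of_nonneg_left (hC (s, v) ⟨hSK hs, hv⟩) (norm_nonneg _)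

end DominatedFamilies

section TaylorCoefficients

variable {f g : ℂ → ℂ}

theorem iteratedDeriv_comp_mul_left (n : ℕ) (f : ℂ → ℂ) (c z : ℂ) :
    iteratedDeriv n (fun w => f (c * w)) z = c ^ n * iteratedDeriv n f (c * z) := by
  induction n generalizing z with
  | zero => simp
  | succ n ih =>
    rw [iteratedDeriv_succ, iteratedDeriv_succ, funext ih, deriv_const_mul_field,
      deriv_comp_mul_left, smul_eq_mul, pow_succ, mul_assoc]

theorem iteratedDeriv_conj_conj (n : ℕ) (f : ℂ → ℂ) :
    iteratedDeriv n (conj ∘ f ∘ conj) = conj ∘ iteratedDeriv n f ∘ conj := by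
  induction n with
  | zero => simp
  | succ n ih => rw [iteratedDeriv_succ, iteratedDeriv_succ, ih, deriv_conj_conj]

theorem hasDerivAt_one_sub_cpow (a : ℂ) {z : ℂ} (hz : 1 - z ∈ Complex.slitPlane) :
    HasDerivAt (fun w => (1 - w) ^ (-a)) (a * (1 - z) ^ (-(a + 1))) z := by
  refine (((hasDerivAt_id' z).const_sub 1).cpow_const (c := -a) hz).congr_deriv ?_
  rw [neg_add']
  ring

theorem iteratedDeriv_one_sub_cpow (a : ℂ) (n : ℕ) {z : ℂ} (hz : 1 - z ∈ Complex.slitPlane) :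
    iteratedDeriv n (fun w => (1 - w) ^ (-a)) z
      = (ascPochhammer ℂ n).eval a * (1 - z) ^ (-(a + n)) := by
  induction n generalizing z with
  | zero => simp
  | succ n ih =>
    have hloc : iteratedDeriv n (fun w => (1 - w) ^ (-a))
        =ᶠ[𝓝 z] fun w => (ascPochhammer ℂ n).eval a * (1 - w) ^ (-(a + n)) := by
      filter_upwards [(Complex.isOpen_slitPlane.preimage (by fun_prop)).mem_nhds hz] with w hw
        using ih hw
    rw [iteratedDeriv_succ, hloc.deriv_eq, ((hasDerivAt_one_sub_cpow _ hz).const_mul _).deriv,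
      ascPochhammer_succ_eval, Nat.cast_succ, mul_assoc, add_assoc]

theorem iteratedDeriv_one_sub_cpow_zero (a : ℂ) (n : ℕ) :
    iteratedDeriv n (fun z => (1 - z) ^ (-a)) 0 = (ascPochhammer ℂ n).eval a := by
  simpa using iteratedDeriv_one_sub_cpow a n (z := 0) (by simp)

/-- Functions analytic at the origin all of whose Taylor coefficients there are nonnegative reals
(with respect to the order `ComplexOrder` of `ℂ`). -/
structure HasNonnegTaylor (f : ℂ → ℂ) : Prop where
  analyticAt : AnalyticAt ℂ f 0
  iteratedDeriv_nonneg : ∀ n, 0 ≤ iteratedDeriv n f 0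

theorem HasNonnegTaylor.mul (hf : HasNonnegTaylor f) (hg : HasNonnegTaylor g) :
    HasNonnegTaylor (fun z => f z * g z) := by
  refine ⟨hf.analyticAt.mul hg.analyticAt, fun n => ?_⟩
  rw [iteratedDeriv_fun_mul hf.analyticAt.contDiffAt hg.analyticAt.contDiffAt]
  exact Finset.sum_nonneg fun i _ =>
    mul_nonneg (mul_nonneg (Nat.cast_nonneg _) (hf.iteratedDeriv_nonneg i))
      (hg.iteratedDeriv_nonneg (n - i))

theorem HasNonnegTaylor.pow (hf : HasNonnegTaylor f) (n : ℕ) :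
    HasNonnegTaylor (fun z => f z ^ n) := by
  induction n with
  | zero =>
    simp only [pow_zero]
    refine ⟨analyticAt_const, fun n => ?_⟩
    rw [iteratedDeriv_const]
    split_ifs <;> simp
  | succ n ih => simpa only [pow_succ] using ih.mul hf

theorem hasNonnegTaylor_one_add : HasNonnegTaylor (fun z => 1 + z) := by
  refine ⟨by fun_prop, fun n => ?_⟩
  match n with
  | 0 => simp
  | 1 => simp [iteratedDeriv_succ]
  | n + 2 => simp [iteratedDeriv_succ', iteratedDeriv_const]

theorem hasNonnegTaylor_one_sub_cpow {e : ℝ} (he : 0 ≤ e) :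
    HasNonnegTaylor (fun z => (1 - z) ^ (-(e : ℂ))) := by
  refine ⟨(by fun_prop : AnalyticAt ℂ (fun z : ℂ => 1 - z) 0).cpow analyticAt_const (by simp),
    fun n => ?_⟩
  rw [iteratedDeriv_one_sub_cpow_zero]
  induction n with
  | zero => simp
  | succ n ih =>
    rw [ascPochhammer_succ_eval]
    refine mul_nonneg ih ?_
    exact_mod_cast add_nonneg he n.cast_nonneg

theorem iteratedDeriv_succ_of_deriv_eq_mul (hf : AnalyticAt ℂ f 0) (hg : AnalyticAt ℂ g 0)
    (h : deriv f =ᶠ[𝓝 0] fun z => g z * f z) (n : ℕ) :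
    iteratedDeriv (n + 1) f 0 = ∑ i ∈ Finset.range (n + 1),
      n.choose i * iteratedDeriv i g 0 * iteratedDeriv (n - i) f 0 := by
  rw [iteratedDeriv_succ', h.iteratedDeriv_eq,
    iteratedDeriv_fun_mul hg.contDiffAt hf.contDiffAt]

theorem iteratedDeriv_pos_of_deriv_eq_mul (hf : AnalyticAt ℂ f 0) (hg : HasNonnegTaylor g)
    (h : deriv f =ᶠ[𝓝 0] fun z => g z * f z) (hf0 : 0 < f 0) (hg0 : 0 < g 0) (n : ℕ) :
    0 < iteratedDeriv n f 0 := by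
  induction n using Nat.strong_induction_on with
  | _ n ih =>
    cases n with
    | zero => simpa using hf0
    | succ n =>
      rw [iteratedDeriv_succ_of_deriv_eq_mul hf hg.analyticAt h]
      refine Finset.sum_pos' (fun i _ => mul_nonneg (mul_nonneg (Nat.cast_nonneg _)
        (hg.iteratedDeriv_nonneg i)) (ih _ (by omega)).le) ⟨0, by simp, ?_⟩
      simpa using mul_pos hg0 (ih n n.lt_succ_self)

theorem frequently_nhdsNE_zero_of_forall_Ioo {p : ℂ → Prop}
    (h : ∀ t : ℝ, t ∈ Set.Ioo 0 1 → p t) : ∃ᶠ z in 𝓝[≠] (0 : ℂ), p z := by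
  have hlim : Tendsto Complex.ofReal (𝓝[>] 0) (𝓝[≠] 0) :=
    tendsto_nhdsWithin_iff.2 ⟨(Complex.continuous_ofReal.tendsto' 0 0 Complex.ofReal_zero).mono_left
      nhdsWithin_le_nhds, eventually_mem_nhdsWithin.mono fun t ht => by
        simpa using (Set.mem_Ioi.1 ht).ne'⟩
  exact hlim.frequently
    (Eventually.frequently (eventually_of_mem (Ioo_mem_nhdsGT one_pos) h))

theorem eventuallyEq_of_eqOn_Ioo (hf : AnalyticAt ℂ f 0) (hg : AnalyticAt ℂ g 0)
    (h : ∀ t : ℝ, t ∈ Set.Ioo 0 1 → f t = g t) : f =ᶠ[𝓝 0] g :=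
  (hf.frequently_eq_iff_eventually_eq hg).1 (frequently_nhdsNE_zero_of_forall_Ioo h)

end TaylorCoefficients

section EulerIntegral

/-- The weight of Euler's Beta integral on `(0, 1)`. -/
noncomputable def betaWeight (p q : ℂ) (s : ℝ) : ℂ := (s : ℂ) ^ (p - 1) * (1 - s : ℂ) ^ (q - 1)

variable {a b c p q : ℂ} {z : ℂ} {s : ℝ}

theorem integral_betaWeight (p q : ℂ) :
    ∫ s in Set.Ioo (0 : ℝ) 1, betaWeight p q s = Complex.betaIntegral p q := by
  rw [Complex.betaIntegral, intervalIntegral.integral_of_le zero_le_one,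
    integral_Ioc_eq_integral_Ioo]
  rfl

theorem integrableOn_betaWeight (hp : 0 < p.re) (hq : 0 < q.re) :
    IntegrableOn (betaWeight p q) (Set.Ioo 0 1) :=
  (intervalIntegrable_iff_integrableOn_Ioo_of_le zero_le_one).1
    (Complex.betaIntegral_convergent hp hq)

theorem betaWeight_mul_pow (hs : s ≠ 0) (n : ℕ) :
    betaWeight p q s * (s : ℂ) ^ n = betaWeight (p + n) q s := by
  rw [betaWeight, betaWeight, add_sub_right_comm, Complex.cpow_add _ _ (by exact_mod_cast hs),
    Complex.cpow_natCast, mul_right_comm]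

theorem Gamma_add_nat (hp : 0 < p.re) (n : ℕ) :
    Complex.Gamma (p + n) = (ascPochhammer ℂ n).eval p * Complex.Gamma p := by
  refine (div_eq_iff (Complex.Gamma_ne_zero_of_re_pos hp)).1
    (Complex.Gamma_add_nat_div_Gamma_eq p fun k hk => ?_)
  rw [hk, Complex.neg_re, Complex.natCast_re] at hp
  linarith [k.cast_nonneg (α := ℝ)]

theorem betaIntegral_add_nat_left (hp : 0 < p.re) (hq : 0 < q.re) (n : ℕ) :
    Complex.betaIntegral (p + n) q =
      (ascPochhammer ℂ n).eval p * Complex.Gamma p * Complex.Gamma q /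
        Complex.Gamma (p + q + n) := by
  have hpn : 0 < (p + n : ℂ).re := by
    rw [Complex.add_re, Complex.natCast_re]
    positivity
  have hpq : Complex.Gamma (p + q + n) ≠ 0 := Complex.Gamma_ne_zero_of_re_pos (by
    rw [Complex.add_re, Complex.natCast_re, Complex.add_re]
    positivity)
  rw [eq_div_iff hpq, ← Gamma_add_nat hp, Complex.Gamma_mul_Gamma_eq_betaIntegral hpn hq,
    add_right_comm, mul_comm]

theorem isOpen_cutPlane : IsOpen cutPlane := by
  have h : cutPlane = (fun z : ℂ => 1 - z) ⁻¹' Complex.slitPlane :=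
    Set.ext fun _ => mem_cutPlane_iff
  exact h ▸ Complex.isOpen_slitPlane.preimage (by fun_prop)

theorem one_sub_mem_slitPlane_of_norm_lt_one (hz : ‖z‖ < 1) : 1 - z ∈ Complex.slitPlane := by
  rw [sub_eq_add_neg]
  exact Complex.mem_slitPlane_of_norm_lt_one (by rwa [norm_neg])

theorem ball_subset_cutPlane : ball (0 : ℂ) 1 ⊆ cutPlane := fun _ hz =>
  mem_cutPlane_iff.2 (one_sub_mem_slitPlane_of_norm_lt_one (mem_ball_zero_iff.1 hz))

theorem one_sub_mul_mem_slitPlane (hs : s ∈ Set.Icc (0 : ℝ) 1) (hz : z ∈ cutPlane) :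
    1 - s * z ∈ Complex.slitPlane := by
  convert Complex.starConvex_one_slitPlane (mem_cutPlane_iff.1 hz) (sub_nonneg.2 hs.2) hs.1
    (sub_add_cancel 1 s) using 1
  simp only [Complex.real_smul, Complex.ofReal_sub, Complex.ofReal_one]
  ring

/-- Euler's integral `∫₀¹ s ^ (p - 1) (1 - s) ^ (q - 1) (1 - s z) ^ (-a) ds`, a multiple of
`𝐅(a, p; p + q; z)`. -/
noncomputable def eulerIntegral (a p q z : ℂ) : ℂ :=
  ∫ s in Set.Ioo (0 : ℝ) 1, betaWeight p q s * (1 - s * z) ^ (-a)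

theorem isDominatedHolomorphic_betaWeight_mul {k : ℝ → ℂ → ℂ} {U : Set ℂ} (hU : IsOpen U)
    (hp : 0 < p.re) (hq : 0 < q.re) (hk : ContinuousOn k.uncurry (Set.Icc 0 1 ×ˢ U))
    (hd : ∀ s ∈ Set.Ioo 0 1, DifferentiableOn ℂ (k s) U) :
    IsDominatedHolomorphic (volume.restrict (Set.Ioo 0 1)) (fun s z => betaWeight p q s * k s z)
      U :=
  .of_continuousOn_compact hU isCompact_Icc Set.Ioo_subset_Icc_self measurableSet_Ioo
    (integrableOn_betaWeight hp hq) hk hd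

theorem isDominatedHolomorphic_euler (a : ℂ) (hp : 0 < p.re) (hq : 0 < q.re) :
    IsDominatedHolomorphic (volume.restrict (Set.Ioo (0 : ℝ) 1))
      (fun s z => betaWeight p q s * (1 - s * z) ^ (-a)) cutPlane := by
  refine isDominatedHolomorphic_betaWeight_mul isOpen_cutPlane hp hq ?_ fun s hs => ?_
  · exact ContinuousOn.cpow_const (by fun_prop) fun x hx => one_sub_mul_mem_slitPlane hx.1 hx.2
  · exact DifferentiableOn.cpow_const (by fun_prop)
      fun z hz => one_sub_mul_mem_slitPlane (Set.Ioo_subset_Icc_self hs) hz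

theorem hasDerivAt_eulerIntegral (a : ℂ) (hp : 0 < p.re) (hq : 0 < q.re) (hz : z ∈ cutPlane) :
    HasDerivAt (eulerIntegral a p q) (a * eulerIntegral (a + 1) (p + 1) q z) z := by
  refine ((isDominatedHolomorphic_euler a hp hq).hasDerivAt_integral hz).congr_deriv ?_
  rw [eulerIntegral, ← integral_const_mul]
  refine setIntegral_congr_fun measurableSet_Ioo fun s hs => ?_
  have hsz := one_sub_mul_mem_slitPlane (Set.Ioo_subset_Icc_self hs) hz
  have hd : deriv (fun w : ℂ => (1 - s * w) ^ (-a)) z = s * (a * (1 - s * z) ^ (-(a + 1))) := by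
    rw [deriv_comp_mul_left (f := fun w => (1 - w) ^ (-a)), (hasDerivAt_one_sub_cpow a hsz).deriv,
      smul_eq_mul]
  have hw : betaWeight p q s * s = betaWeight (p + 1) q s := by
    simpa using betaWeight_mul_pow (p := p) (q := q) hs.1.ne' 1
  rw [deriv_const_mul_field, hd, ← hw]
  ring

theorem iteratedDeriv_eulerIntegral_zero (a : ℂ) (hp : 0 < p.re) (hq : 0 < q.re) (n : ℕ) :
    iteratedDeriv n (eulerIntegral a p q) 0
      = (ascPochhammer ℂ n).eval a * Complex.betaIntegral (p + n) q := by
  have h0 : (0 : ℂ) ∈ cutPlane := ball_subset_cutPlane (mem_ball_self one_pos)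
  rw [← integral_betaWeight, ← integral_const_mul]
  refine ((isDominatedHolomorphic_euler a hp hq).iteratedDeriv_integral h0 n).trans
    (setIntegral_congr_fun measurableSet_Ioo fun s hs => ?_)
  rw [iteratedDeriv_const_mul_field, iteratedDeriv_comp_mul_left n (fun w => (1 - w) ^ (-a)),
    mul_zero, iteratedDeriv_one_sub_cpow_zero, ← betaWeight_mul_pow hs.1.ne']
  ring

theorem hasSum_regularizedGaussHGFun (a b c : ℂ) (hz : ‖z‖ < 1) :
    HasSum (fun n : ℕ => (ascPochhammer ℂ n).eval a * (ascPochhammer ℂ n).eval b /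
      (n.factorial * Complex.Gamma (c + n)) * z ^ n) (Complex.regularizedGaussHGFun a b c z) := by
  have hmem : z ∈ Metric.eball 0 (Complex.regularizedGaussHGFunSeries a b c).radius := by
    refine Metric.eball_subset_eball (Complex.radius_regularizedGaussHGFunSeries_ge_one a b c) ?_
    rwa [← ENNReal.ofReal_one, Metric.eball_ofReal, mem_ball_zero_iff]
  refine ((Complex.regularizedGaussHGFunSeries a b c).hasSum hmem).congr_fun fun n => ?_
  rw [FormalMultilinearSeries.apply_eq_pow_smul_coeff,
    Complex.coeff_regularizedGaussHGFunSeries, smul_eq_mul, mul_comm]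

theorem isHypergeometricContinuation_eulerIntegral (a : ℂ) (hb : 0 < b.re) (hc : 0 < (c - b).re) :
    IsHypergeometricContinuation a b c fun z =>
      (Complex.Gamma b * Complex.Gamma (c - b))⁻¹ * eulerIntegral a b (c - b) z := by
  have hd : DifferentiableOn ℂ (eulerIntegral a b (c - b)) cutPlane :=
    (isDominatedHolomorphic_euler a hb hc).differentiableOn_integral
  refine ⟨hd.const_mul _, fun z hz => ?_⟩
  refine HasSum.unique ?_ (hasSum_regularizedGaussHGFun a b c hz)
  refine ((Complex.hasSum_taylorSeries_on_ball (hd.mono ball_subset_cutPlane)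
    (mem_ball_zero_iff.2 hz)).mul_left _).congr_fun fun n => ?_
  have hb0 := Complex.Gamma_ne_zero_of_re_pos hb
  have hc0 := Complex.Gamma_ne_zero_of_re_pos hc
  rw [iteratedDeriv_eulerIntegral_zero a hb hc n,
    betaIntegral_add_nat_left hb hc, add_sub_cancel, sub_zero, smul_eq_mul, smul_eq_mul]
  field_simp

theorem isHypergeometricContinuation_regularizedF {F : ℂ → ℂ}
    (h : IsHypergeometricContinuation a b c F) :
    IsHypergeometricContinuation a b c (regularizedF a b c) := by
  rw [regularizedF, dif_pos ⟨F, h⟩]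
  exact Exists.choose_spec (p := IsHypergeometricContinuation a b c) ⟨F, h⟩

theorem differentiableOn_regularizedF (a : ℂ) (hb : 0 < b.re) (hc : 0 < (c - b).re) :
    DifferentiableOn ℂ (regularizedF a b c) cutPlane :=
  (isHypergeometricContinuation_regularizedF
    (isHypergeometricContinuation_eulerIntegral a hb hc)).1

theorem regularizedF_eq_eulerIntegral (a : ℂ) (hb : 0 < b.re) (hc : 0 < (c - b).re)
    (hz : z ∈ cutPlane) :
    regularizedF a b c z
      = (Complex.Gamma b * Complex.Gamma (c - b))⁻¹ * eulerIntegral a b (c - b) z :=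
  have h := isHypergeometricContinuation_eulerIntegral a hb hc
  (isHypergeometricContinuation_regularizedF h).eqOn h hz

theorem regularizedF_comm (a b c : ℂ) : regularizedF a b c = regularizedF b a c := by
  have h : IsHypergeometricContinuation a b c = IsHypergeometricContinuation b a c := by
    funext F
    rw [IsHypergeometricContinuation, IsHypergeometricContinuation,
      Complex.regularizedGaussHGFun_symm]
  rw [regularizedF, regularizedF, Complex.regularizedGaussHGFun_symm a b, h]

end EulerIntegral

section MoebiusInvariance

variable {p q : ℂ} {l s : ℝ}

/-- The Möbius transformation of `(0, 1)` which multiplies the coordinate `s / (1 - s)` by `l`. -/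
noncomputable def moebius (l s : ℝ) : ℝ := l * s / (1 - s + l * s)

theorem moebius_denom_pos (hl : 0 < l) (hs : s ∈ Set.Ioo (0 : ℝ) 1) : 0 < 1 - s + l * s :=
  add_pos (sub_pos.2 hs.2) (mul_pos hl hs.1)

theorem one_sub_moebius (hl : 0 < l) (hs : s ∈ Set.Ioo (0 : ℝ) 1) :
    1 - moebius l s = (1 - s) / (1 - s + l * s) := by
  rw [moebius, one_sub_div (moebius_denom_pos hl hs).ne', add_sub_cancel_right]

theorem moebius_mem_Ioo (hl : 0 < l) (hs : s ∈ Set.Ioo (0 : ℝ) 1) :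
    moebius l s ∈ Set.Ioo (0 : ℝ) 1 := by
  have hN := moebius_denom_pos hl hs
  refine ⟨div_pos (mul_pos hl hs.1) hN, sub_pos.1 ?_⟩
  rw [one_sub_moebius hl hs]
  exact div_pos (sub_pos.2 hs.2) hN

theorem moebius_inv_moebius (hl : 0 < l) (hs : s ∈ Set.Ioo (0 : ℝ) 1) :
    moebius l⁻¹ (moebius l s) = s := by
  have hN := moebius_denom_pos hl hs
  rw [moebius, one_sub_moebius hl hs, moebius]
  field_simp
  ring

theorem bijOn_moebius (hl : 0 < l) : Set.BijOn (moebius l) (Set.Ioo 0 1) (Set.Ioo 0 1) :=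
  Set.InvOn.bijOn ⟨fun _ => moebius_inv_moebius hl, fun s hs => by
      simpa only [inv_inv] using moebius_inv_moebius (inv_pos.2 hl) hs⟩
    (fun _ => moebius_mem_Ioo hl) fun _ => moebius_mem_Ioo (inv_pos.2 hl)

theorem hasDerivAt_moebius (hl : 0 < l) (hs : s ∈ Set.Ioo (0 : ℝ) 1) :
    HasDerivAt (moebius l) (l / (1 - s + l * s) ^ 2) s := by
  have hnum : HasDerivAt (fun s : ℝ => l * s) l s := by
    simpa using (hasDerivAt_id s).const_mul l
  have hden : HasDerivAt (fun s : ℝ => 1 - s + l * s) (-1 + l) s :=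
    ((hasDerivAt_id' s).const_sub 1).add hnum
  refine (hnum.div hden (moebius_denom_pos hl hs).ne').congr_deriv ?_
  congr 1
  ring

theorem integral_comp_moebius {E : Type*} [NormedAddCommGroup E] [NormedSpace ℝ E] (hl : 0 < l)
    (g : ℝ → E) :
    ∫ s in Set.Ioo (0 : ℝ) 1, g s
      = ∫ s in Set.Ioo (0 : ℝ) 1, (l / (1 - s + l * s) ^ 2) • g (moebius l s) := by
  conv_lhs => rw [← (bijOn_moebius hl).image_eq]
  rw [integral_image_eq_integral_abs_deriv_smul measurableSet_Ioo
    (fun s hs => (hasDerivAt_moebius hl hs).hasDerivWithinAt) (bijOn_moebius hl).injOn]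
  refine setIntegral_congr_fun measurableSet_Ioo fun s hs => ?_
  have := moebius_denom_pos hl hs
  simp only [abs_of_pos (show 0 < l / (1 - s + l * s) ^ 2 by positivity)]

theorem ofReal_cpow_eq_exp {x : ℝ} (hx : 0 < x) (e : ℂ) :
    (x : ℂ) ^ e = Complex.exp (e * Real.log x) := by
  rw [Complex.cpow_def_of_ne_zero (by exact_mod_cast hx.ne'), Complex.ofReal_log hx.le, mul_comm]

theorem betaWeight_moebius (p q : ℂ) (hl : 0 < l) (hs : s ∈ Set.Ioo (0 : ℝ) 1) :
    (l / (1 - s + l * s) ^ 2) • betaWeight p q (moebius l s)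
      = (l : ℂ) ^ p * ((1 - s + l * s : ℝ) : ℂ) ^ (-(p + q)) * betaWeight p q s := by
  have hN := moebius_denom_pos hl hs
  have hs0 := hs.1
  have hs1 := sub_pos.2 hs.2
  have hjac : ((l / (1 - s + l * s) ^ 2 : ℝ) : ℂ)
      = Complex.exp (Real.log l - 2 * Real.log (1 - s + l * s)) := by
    rw [← Complex.cpow_one ((l / _ : ℝ) : ℂ), ofReal_cpow_eq_exp (by positivity),
      Real.log_div hl.ne' (by positivity), Real.log_pow]
    push_cast
    ring_nf
  simp only [betaWeight, Complex.real_smul, ← Complex.ofReal_one, ← Complex.ofReal_sub]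
  rw [one_sub_moebius hl hs, moebius, hjac, ofReal_cpow_eq_exp (by positivity),
    ofReal_cpow_eq_exp (by positivity), ofReal_cpow_eq_exp hl, ofReal_cpow_eq_exp hN,
    ofReal_cpow_eq_exp hs0, ofReal_cpow_eq_exp hs1, Real.log_div (by positivity) hN.ne',
    Real.log_div hs1.ne' hN.ne', Real.log_mul hl.ne' hs0.ne']
  simp only [← Complex.exp_add]
  congr 1
  push_cast
  ring

theorem integral_betaWeight_mul_homogeneous {Φ : ℝ → ℝ → ℂ}
    (hΦ : ∀ t x y : ℝ, 0 < t → 0 < x → 0 < y → Φ (t * x) (t * y) = (t : ℂ) ^ (-(p + q)) * Φ x y)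
    {μ ν : ℝ} (hμ : 0 < μ) (hν : 0 < ν) :
    ∫ s in Set.Ioo (0 : ℝ) 1, betaWeight p q s * Φ (μ * (1 - s)) (ν * s)
      = (μ : ℂ) ^ (-q) * (ν : ℂ) ^ (-p) *
        ∫ s in Set.Ioo (0 : ℝ) 1, betaWeight p q s * Φ (1 - s) s := by
  have hl := div_pos hμ hν
  rw [integral_comp_moebius hl, ← integral_const_mul]
  refine setIntegral_congr_fun measurableSet_Ioo fun s hs => ?_
  have hN := moebius_denom_pos hl hs
  set N := 1 - s + μ / ν * s with hNdef
  have hx : μ * (1 - moebius (μ / ν) s) = μ / N * (1 - s) := by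
    rw [one_sub_moebius hl hs, ← hNdef]
    ring
  have hy : ν * moebius (μ / ν) s = μ / N * s := by
    rw [moebius, ← hNdef]
    field_simp
  have hfactor : ((μ / ν : ℝ) : ℂ) ^ p * (N : ℂ) ^ (-(p + q)) * ((μ / N : ℝ) : ℂ) ^ (-(p + q))
      = (μ : ℂ) ^ (-q) * (ν : ℂ) ^ (-p) := by
    rw [ofReal_cpow_eq_exp hl, ofReal_cpow_eq_exp hN, ofReal_cpow_eq_exp (div_pos hμ hN),
      ofReal_cpow_eq_exp hμ, ofReal_cpow_eq_exp hν, Real.log_div hμ.ne' hN.ne',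
      Real.log_div hμ.ne' hν.ne']
    simp only [← Complex.exp_add]
    congr 1
    push_cast
    ring
  rw [hx, hy, hΦ _ _ _ (div_pos hμ hN) (sub_pos.2 hs.2) hs.1, ← smul_mul_assoc,
    betaWeight_moebius p q hl hs, ← hfactor]
  ring

end MoebiusInvariance

section KoebeMap

variable {z : ℂ} {ρ : ℝ}

theorem ofReal_mul_cpow_mul_cpow {t x y : ℝ} (ht : 0 < t) (hx : 0 < x) (hy : 0 < y) (α β : ℂ) :
    ((t * x : ℝ) : ℂ) ^ α * ((t * y : ℝ) : ℂ) ^ β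
      = (t : ℂ) ^ (α + β) * ((x : ℂ) ^ α * (y : ℂ) ^ β) := by
  rw [Complex.ofReal_mul, Complex.ofReal_mul, Complex.mul_cpow_ofReal_nonneg ht.le hx.le,
    Complex.mul_cpow_ofReal_nonneg ht.le hy.le, Complex.cpow_add _ _ (by exact_mod_cast ht.ne')]
  ring

theorem integral_betaWeight_mul_cpow_rescale (a p q : ℂ) {μ ν x y : ℝ} (hμ : 0 < μ) (hν : 0 < ν)
    (hx : 0 < x) (hy : 0 < y) :
    ∫ s in Set.Ioo (0 : ℝ) 1, betaWeight p q s * ((μ * (1 - s) * x + ν * s * y : ℝ) : ℂ) ^ (-a)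
      = (μ : ℂ) ^ (p - a) * (ν : ℂ) ^ (q - a) * ∫ s in Set.Ioo (0 : ℝ) 1, betaWeight p q s *
        ((((1 - s) * ν + s * μ : ℝ) : ℂ) ^ (a - (p + q)) *
          (((1 - s) * x + s * y : ℝ) : ℂ) ^ (-a)) := by
  have hμν := mul_pos hμ hν
  have hscale := integral_betaWeight_mul_homogeneous (p := p) (q := q) (Φ := fun t r =>
    ((t * ν + r * μ : ℝ) : ℂ) ^ (a - (p + q)) * ((t * x + r * y : ℝ) : ℂ) ^ (-a))
    (fun t r r' ht hr hr' => by
      rw [show -(p + q) = a - (p + q) + -a by ring,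
        ← ofReal_mul_cpow_mul_cpow ht (by positivity) (by positivity)]
      simp only [mul_add, mul_assoc]) hμ hν
  have hconst (s : ℝ) : μ * (1 - s) * ν + ν * s * μ = μ * ν := by ring
  have hpre : ((μ * ν : ℝ) : ℂ) ^ (a - (p + q)) * ((μ : ℂ) ^ (p - a) * (ν : ℂ) ^ (q - a))
      = (μ : ℂ) ^ (-q) * (ν : ℂ) ^ (-p) := by
    rw [ofReal_cpow_eq_exp hμν, Real.log_mul hμ.ne' hν.ne']
    simp only [ofReal_cpow_eq_exp hμ, ofReal_cpow_eq_exp hν, ← Complex.exp_add]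
    congr 1
    push_cast
    ring
  have hne : ((μ * ν : ℝ) : ℂ) ^ (a - (p + q)) ≠ 0 :=
    Complex.cpow_ne_zero_iff.2 (Or.inl (by exact_mod_cast hμν.ne'))
  simp only [hconst] at hscale
  refine mul_left_cancel₀ hne ?_
  rw [← mul_assoc, hpre, ← hscale, ← integral_const_mul]
  simp only [mul_left_comm (betaWeight p q _)]

/-- The conformal map of the unit disc onto the cut plane whose inverse is the radial variable
`ρ`. -/
noncomputable def koebe (ρ : ℂ) : ℂ := 4 * ρ / (1 + ρ) ^ 2

theorem norm_ofReal_lt_one_of_mem_Ioo (hρ : ρ ∈ Set.Ioo (0 : ℝ) 1) : ‖(ρ : ℂ)‖ < 1 := by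
  rw [Complex.norm_of_nonneg hρ.1.le]
  exact hρ.2

theorem koebe_zero : koebe 0 = 0 := by simp [koebe]

theorem one_add_ne_zero_of_norm_lt_one (hz : ‖z‖ < 1) : 1 + z ≠ 0 := fun h => by
  simp [eq_neg_of_add_eq_zero_right h] at hz

theorem cayley_re_pos (hz : ‖z‖ < 1) : 0 < ((1 - z) / (1 + z)).re := by
  have hsq : z.re * z.re + z.im * z.im < 1 := by
    rw [← Complex.normSq_apply, Complex.normSq_eq_norm_sq]
    exact pow_lt_one₀ (norm_nonneg z) hz two_ne_zero
  rw [Complex.div_re, ← add_div]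
  refine div_pos ?_ (Complex.normSq_pos.2 (one_add_ne_zero_of_norm_lt_one hz))
  simp only [Complex.sub_re, Complex.sub_im, Complex.add_re, Complex.add_im, Complex.one_re,
    Complex.one_im]
  linarith

theorem mul_mem_slitPlane_of_re_pos {w : ℂ} (hz : 0 < z.re) (hw : 0 < w.re) :
    z * w ∈ Complex.slitPlane := by
  rw [Complex.mem_slitPlane_iff, Complex.mul_re, Complex.mul_im, or_iff_not_imp_right, not_not]
  intro him
  refine pos_of_mul_pos_left ?_ hw.le
  calc 0 < z.re * (w.re ^ 2 + w.im ^ 2) := by positivity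
    _ = (z.re * w.re - z.im * w.im) * w.re := by linear_combination w.im * him

theorem one_sub_koebe (hz : ‖z‖ < 1) : 1 - koebe z = ((1 - z) / (1 + z)) ^ 2 := by
  have := one_add_ne_zero_of_norm_lt_one hz
  rw [koebe]
  field_simp
  ring

theorem koebe_mem_cutPlane (hz : ‖z‖ < 1) : koebe z ∈ cutPlane := by
  rw [mem_cutPlane_iff, one_sub_koebe hz, sq]
  exact mul_mem_slitPlane_of_re_pos (cayley_re_pos hz) (cayley_re_pos hz)

theorem hasDerivAt_koebe (hz : ‖z‖ < 1) :
    HasDerivAt koebe (4 * (1 - z) / (1 + z) ^ 3) z := by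
  have h := one_add_ne_zero_of_norm_lt_one hz
  refine (((hasDerivAt_id' z).const_mul 4).div (((hasDerivAt_id' z).const_add 1).pow 2)
    (pow_ne_zero 2 h)).congr_deriv ?_
  simp only [mul_one, Nat.cast_ofNat, Nat.add_one_sub_one, pow_one, Pi.pow_apply]
  field_simp
  ring

theorem differentiableOn_comp_koebe {F : ℂ → ℂ} (hF : DifferentiableOn ℂ F cutPlane) :
    DifferentiableOn ℂ (fun ρ => F (koebe ρ)) (ball 0 1) :=
  fun _ hz => DifferentiableAt.differentiableWithinAt <|
    (hF.differentiableAt (isOpen_cutPlane.mem_nhds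
      (koebe_mem_cutPlane (mem_ball_zero_iff.1 hz)))).comp _
        (hasDerivAt_koebe (mem_ball_zero_iff.1 hz)).differentiableAt

theorem eulerIntegral_koebe (a p q : ℂ) (hρ : ρ ∈ Set.Ioo (0 : ℝ) 1) :
    eulerIntegral a p q (koebe ρ) = ((1 + ρ : ℝ) : ℂ) ^ (2 * a) *
      ∫ s in Set.Ioo (0 : ℝ) 1, betaWeight p q s *
        (((1 - s) * (1 + ρ) ^ 2 + s * (1 - ρ) ^ 2 : ℝ) : ℂ) ^ (-a) := by
  rw [eulerIntegral, ← integral_const_mul]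
  refine setIntegral_congr_fun measurableSet_Ioo fun s hs => ?_
  have hA : 0 < 1 + ρ := by linarith [hρ.1]
  have hB : 0 < 1 - ρ := sub_pos.2 hρ.2
  have hX : 0 < (1 - s) * (1 + ρ) ^ 2 + s * (1 - ρ) ^ 2 := by
    have := hs.1
    have := sub_pos.2 hs.2
    positivity
  have hbase : 1 - s * koebe ρ
      = (((1 - s) * (1 + ρ) ^ 2 + s * (1 - ρ) ^ 2) / (1 + ρ) ^ 2 : ℝ) := by
    have : (1 + ρ : ℂ) ≠ 0 := by exact_mod_cast hA.ne'
    rw [koebe]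
    push_cast
    field_simp
    ring
  have hcpow : (1 - s * koebe ρ) ^ (-a) = ((1 + ρ : ℝ) : ℂ) ^ (2 * a) *
      (((1 - s) * (1 + ρ) ^ 2 + s * (1 - ρ) ^ 2 : ℝ) : ℂ) ^ (-a) := by
    rw [hbase, ofReal_cpow_eq_exp (div_pos hX (pow_pos hA 2)), ofReal_cpow_eq_exp hA,
      ofReal_cpow_eq_exp hX, Real.log_div hX.ne' (by positivity), Real.log_pow, ← Complex.exp_add]
    congr 1
    push_cast
    ring
  rw [hcpow]
  ring

/-- The generating function `(1 - t) ^ (a - c) (1 + t) ^ (-a)` of Meixner–Pollaczek polynomials. -/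
noncomputable def meixnerKernel (a c t : ℂ) : ℂ := (1 - t) ^ (a - c) * (1 + t) ^ (-a)

theorem eulerIntegral_koebe_eq_integral_meixnerKernel (a p q : ℂ) (hρ : ρ ∈ Set.Ioo (0 : ℝ) 1) :
    eulerIntegral a p q (koebe ρ) = (1 + ρ : ℂ) ^ (a + p) * (1 - ρ : ℂ) ^ (q - a) *
      ∫ s in Set.Ioo (0 : ℝ) 1, betaWeight p q s * meixnerKernel a (p + q) ((1 - 2 * s) * ρ) := by
  have hA : 0 < 1 + ρ := by linarith [hρ.1]
  have hB : 0 < 1 - ρ := sub_pos.2 hρ.2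
  have hX (s : ℝ) : (1 - s) * (1 + ρ) ^ 2 + s * (1 - ρ) ^ 2
      = (1 + ρ) * (1 - s) * (1 + ρ) + (1 - ρ) * s * (1 - ρ) := by
    ring
  have hkernel (s : ℝ) : (((1 - s) * (1 - ρ) + s * (1 + ρ) : ℝ) : ℂ) ^ (a - (p + q)) *
        (((1 - s) * (1 + ρ) + s * (1 - ρ) : ℝ) : ℂ) ^ (-a)
      = meixnerKernel a (p + q) ((1 - 2 * s) * ρ) := by
    rw [meixnerKernel]
    congr 2 <;> push_cast <;> ring
  simp only [eulerIntegral_koebe a p q hρ, hX,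
    integral_betaWeight_mul_cpow_rescale a p q hA hB hA hB, hkernel]
  rw [← mul_assoc, ← mul_assoc, ← Complex.cpow_add _ _ (by exact_mod_cast hA.ne'),
    two_mul, add_assoc, add_sub_cancel, Complex.ofReal_add, Complex.ofReal_sub, Complex.ofReal_one]

end KoebeMap

section MeixnerExpansion

variable {p q : ℂ}

theorem one_sub_two_mul_norm_le_one {s : ℝ} (hs : s ∈ Set.Icc (0 : ℝ) 1) :
    ‖(1 - 2 * s : ℂ)‖ ≤ 1 := by
  have h : (1 - 2 * s : ℂ) = (1 - 2 * s : ℝ) := by push_cast; rfl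
  rw [h, Complex.norm_real, Real.norm_eq_abs, abs_le]
  constructor <;> linarith [hs.1, hs.2]

theorem norm_one_sub_two_mul_mul_lt_one {s : ℝ} {z : ℂ} (hs : s ∈ Set.Icc (0 : ℝ) 1)
    (hz : z ∈ ball (0 : ℂ) 1) : ‖(1 - 2 * s) * z‖ < 1 := by
  rw [norm_mul]
  exact (mul_le_of_le_one_left (norm_nonneg z) (one_sub_two_mul_norm_le_one hs)).trans_lt
    (mem_ball_zero_iff.1 hz)

theorem differentiableOn_meixnerKernel (a c : ℂ) :
    DifferentiableOn ℂ (meixnerKernel a c) (ball 0 1) := by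
  intro t ht
  have ht' := mem_ball_zero_iff.1 ht
  exact (DifferentiableWithinAt.cpow_const (by fun_prop)
    (one_sub_mem_slitPlane_of_norm_lt_one ht')).mul (DifferentiableWithinAt.cpow_const
      (by fun_prop) (Complex.mem_slitPlane_of_norm_lt_one ht'))

theorem analyticAt_meixnerKernel (a c : ℂ) : AnalyticAt ℂ (meixnerKernel a c) 0 :=
  (differentiableOn_meixnerKernel a c).analyticAt (ball_mem_nhds 0 one_pos)

theorem isDominatedHolomorphic_betaWeight_mul_comp {h : ℂ → ℂ} (hp : 0 < p.re) (hq : 0 < q.re)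
    (hh : DifferentiableOn ℂ h (ball 0 1)) :
    IsDominatedHolomorphic (volume.restrict (Set.Ioo (0 : ℝ) 1))
      (fun s z => betaWeight p q s * h ((1 - 2 * s) * z)) (ball 0 1) := by
  refine isDominatedHolomorphic_betaWeight_mul isOpen_ball hp hq ?_ fun s hs => ?_
  · exact hh.continuousOn.comp (by fun_prop) fun x hx =>
      mem_ball_zero_iff.2 (norm_one_sub_two_mul_mul_lt_one hx.1 hx.2)
  · exact hh.comp (by fun_prop) fun z hz =>
      mem_ball_zero_iff.2 (norm_one_sub_two_mul_mul_lt_one (Set.Ioo_subset_Icc_self hs) hz)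

theorem analyticAt_integral_betaWeight_mul_comp {h : ℂ → ℂ} (hp : 0 < p.re) (hq : 0 < q.re)
    (hh : DifferentiableOn ℂ h (ball 0 1)) :
    AnalyticAt ℂ (fun z => ∫ s in Set.Ioo (0 : ℝ) 1, betaWeight p q s * h ((1 - 2 * s) * z)) 0 :=
  (isDominatedHolomorphic_betaWeight_mul_comp hp hq hh).differentiableOn_integral.analyticAt
    (ball_mem_nhds 0 one_pos)

theorem iteratedDeriv_integral_betaWeight_mul_comp {h : ℂ → ℂ} (hp : 0 < p.re) (hq : 0 < q.re)
    (hh : DifferentiableOn ℂ h (ball 0 1)) (n : ℕ) :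
    iteratedDeriv n (fun z => ∫ s in Set.Ioo (0 : ℝ) 1, betaWeight p q s * h ((1 - 2 * s) * z)) 0
      = (∫ s in Set.Ioo (0 : ℝ) 1, betaWeight p q s * (1 - 2 * s) ^ n) * iteratedDeriv n h 0 := by
  rw [(isDominatedHolomorphic_betaWeight_mul_comp hp hq hh).iteratedDeriv_integral
    (mem_ball_self one_pos), ← integral_mul_const]
  refine setIntegral_congr_fun measurableSet_Ioo fun s _ => ?_
  rw [iteratedDeriv_const_mul_field, iteratedDeriv_comp_mul_left n h, mul_zero, mul_assoc]

theorem integral_betaWeight_mul_one_sub_cpow (p q : ℂ) {t : ℝ} (ht : t ∈ Set.Ioo (0 : ℝ) 1) :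
    ∫ s in Set.Ioo (0 : ℝ) 1, betaWeight p q s * (1 - (1 - 2 * s) * t : ℂ) ^ (-(p + q))
      = Complex.betaIntegral p q * meixnerKernel p (p + q) t := by
  have hscale := integral_betaWeight_mul_homogeneous (p := p) (q := q)
    (Φ := fun x y => ((x + y : ℝ) : ℂ) ^ (-(p + q))) (fun t x y ht hx hy => by
      rw [← mul_add, Complex.ofReal_mul, Complex.mul_cpow_ofReal_nonneg ht.le (add_pos hx hy).le])
    (sub_pos.2 ht.2) (add_pos one_pos ht.1)
  simp only [sub_add_cancel, Complex.ofReal_one, Complex.one_cpow, mul_one,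
    integral_betaWeight] at hscale
  rw [meixnerKernel, sub_add_cancel_left, ← Complex.ofReal_one, ← Complex.ofReal_add,
    ← Complex.ofReal_sub, mul_comm, ← hscale]
  refine setIntegral_congr_fun measurableSet_Ioo fun s _ => ?_
  congr 2
  push_cast
  ring

theorem ascPochhammer_mul_integral_betaWeight_mul_pow (hp : 0 < p.re) (hq : 0 < q.re) (n : ℕ) :
    (ascPochhammer ℂ n).eval (p + q) *
        ∫ s in Set.Ioo (0 : ℝ) 1, betaWeight p q s * (1 - 2 * s) ^ n
      = Complex.betaIntegral p q * iteratedDeriv n (meixnerKernel p (p + q)) 0 := by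
  have hd : DifferentiableOn ℂ (fun z : ℂ => (1 - z) ^ (-(p + q))) (ball 0 1) :=
    DifferentiableOn.cpow_const (by fun_prop) fun z hz =>
      one_sub_mem_slitPlane_of_norm_lt_one (mem_ball_zero_iff.1 hz)
  have heq := eventuallyEq_of_eqOn_Ioo (analyticAt_integral_betaWeight_mul_comp hp hq hd)
    (analyticAt_const.fun_mul (analyticAt_meixnerKernel p (p + q)))
    fun t ht => integral_betaWeight_mul_one_sub_cpow p q ht
  rw [mul_comm, ← iteratedDeriv_one_sub_cpow_zero, ← iteratedDeriv_integral_betaWeight_mul_comp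
    hp hq hd, heq.iteratedDeriv_eq, iteratedDeriv_const_mul_field]

theorem meixnerKernel_conj (a c : ℂ) {t : ℂ} (ht : ‖t‖ < 1) :
    meixnerKernel (conj a) (conj c) t = conj (meixnerKernel a c (conj t)) := by
  have h (e : ℂ) {z : ℂ} (hz : ‖z‖ < 1) : (1 + z) ^ conj e = conj ((1 + conj z) ^ e) := by
    rw [Complex.cpow_conj _ _ (Complex.slitPlane_arg_ne_pi
      (Complex.mem_slitPlane_of_norm_lt_one hz)), map_add, map_one]
  have hneg := h (a - c) (z := -t) (by rwa [norm_neg])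
  have hpos := h (-a) ht
  simp only [map_neg, ← sub_eq_add_neg, map_sub] at hneg hpos
  rw [meixnerKernel, meixnerKernel, map_mul, hneg, hpos]

theorem iteratedDeriv_meixnerKernel_conj (a c : ℂ) (n : ℕ) :
    iteratedDeriv n (meixnerKernel (conj a) (conj c)) 0
      = conj (iteratedDeriv n (meixnerKernel a c) 0) := by
  have h : meixnerKernel (conj a) (conj c) =ᶠ[𝓝 0] conj ∘ meixnerKernel a c ∘ conj := by
    filter_upwards [ball_mem_nhds 0 one_pos] with t ht
      using meixnerKernel_conj a c (mem_ball_zero_iff.1 ht)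
  rw [h.iteratedDeriv_eq, iteratedDeriv_conj_conj, Function.comp_apply, Function.comp_apply,
    map_zero]

end MeixnerExpansion

section PrincipalSeries

variable {a : ℂ} {c : ℝ}

theorem iteratedDeriv_integral_meixnerKernel (ha : 0 < a.re) (hc : a.re < c) (n : ℕ) :
    iteratedDeriv n (fun z => (Complex.Gamma (conj a) * Complex.Gamma (c - conj a))⁻¹ *
        ∫ s in Set.Ioo (0 : ℝ) 1, betaWeight (conj a) (c - conj a) s *
          meixnerKernel a c ((1 - 2 * s) * z)) 0
      = (‖iteratedDeriv n (meixnerKernel a c) 0‖ ^ 2 / Real.Gamma (c + n) : ℝ) := by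
  have hp : 0 < (conj a).re := ha
  have hq : 0 < (c - conj a).re := by simpa using hc
  have hmoment := ascPochhammer_mul_integral_betaWeight_mul_pow hp hq n
  have hΓ := Complex.Gamma_mul_Gamma_eq_betaIntegral hp hq
  have hc0 : 0 < (c : ℂ).re := ha.trans hc
  have hΓn : Complex.Gamma (c + n) ≠ 0 := Complex.Gamma_ne_zero_of_re_pos (by
    rw [Complex.add_re, Complex.natCast_re]; positivity)
  rw [add_sub_cancel] at hmoment hΓ
  rw [iteratedDeriv_const_mul_field, iteratedDeriv_integral_betaWeight_mul_comp hp hq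
    (differentiableOn_meixnerKernel a c), inv_mul_eq_iff_eq_mul₀ (mul_ne_zero
      (Complex.Gamma_ne_zero_of_re_pos hp) (Complex.Gamma_ne_zero_of_re_pos hq)), hΓ,
    Complex.ofReal_div, ← Complex.Gamma_ofReal, mul_div_assoc', Complex.ofReal_add,
    Complex.ofReal_natCast, eq_div_iff hΓn, Complex.ofReal_pow, ← Complex.conj_mul',
    ← iteratedDeriv_meixnerKernel_conj, Complex.conj_ofReal, Gamma_add_nat hc0]
  linear_combination Complex.Gamma c * iteratedDeriv n (meixnerKernel a c) 0 * hmoment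

theorem hasNonnegTaylor_regularizedF_koebe_of_conj {d : ℕ} (had : 2 * a.re = d) (hc : a.re < c)
    (hcd : c ≤ d) : HasNonnegTaylor fun ρ => regularizedF a (conj a) c (koebe ρ) := by
  have ha : 0 < a.re := by linarith
  have hp : 0 < (conj a).re := ha
  have hq : 0 < (c - conj a).re := by simpa using hc
  have hS : HasNonnegTaylor fun z => (Complex.Gamma (conj a) * Complex.Gamma (c - conj a))⁻¹ *
      ∫ s in Set.Ioo (0 : ℝ) 1, betaWeight (conj a) (c - conj a) s *
        meixnerKernel a c ((1 - 2 * s) * z) := by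
    refine ⟨analyticAt_const.fun_mul (analyticAt_integral_betaWeight_mul_comp hp hq
      (differentiableOn_meixnerKernel a c)), fun n => ?_⟩
    rw [iteratedDeriv_integral_meixnerKernel ha hc]
    have := Real.Gamma_nonneg_of_nonneg (s := c + n) (by linarith [n.cast_nonneg (α := ℝ)])
    exact_mod_cast div_nonneg (sq_nonneg _) this
  have hprod := ((hasNonnegTaylor_one_add.pow d).mul
    (hasNonnegTaylor_one_sub_cpow (sub_nonneg.2 hcd))).mul hS
  have hF : AnalyticAt ℂ (fun ρ => regularizedF a (conj a) c (koebe ρ)) 0 :=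
    (differentiableOn_comp_koebe (differentiableOn_regularizedF a hp hq)).analyticAt
      (ball_mem_nhds 0 one_pos)
  have heq := eventuallyEq_of_eqOn_Ioo hF hprod.analyticAt fun t ht => ?_
  · exact ⟨hF, fun n => heq.iteratedDeriv_eq n ▸ hprod.iteratedDeriv_nonneg n⟩
  · have hsum : a + conj a = d := by
      rw [Complex.add_conj, had, Complex.ofReal_natCast]
    have hexp : (c : ℂ) - conj a - a = -((d - c : ℝ) : ℂ) := by
      rw [Complex.ofReal_sub, Complex.ofReal_natCast, ← hsum]
      ring
    rw [regularizedF_eq_eulerIntegral a hp hq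
      (koebe_mem_cutPlane (norm_ofReal_lt_one_of_mem_Ioo ht)),
      eulerIntegral_koebe_eq_integral_meixnerKernel _ _ _ ht, add_sub_cancel, hsum, hexp,
      Complex.cpow_natCast]
    ring

end PrincipalSeries

section RadialKernel

variable {b κ x : ℝ} {u z : ℂ}

/-- The kernel `(1 + ρ) ^ (2 b - 1) (1 - ρ) ^ (-(2 b + 1 + 2 κ)) (1 + 2 x ρ + ρ ^ 2) ^ κ`, averages
of which over `x` give the radial derivative of a hypergeometric function. -/
noncomputable def radialKernel (b κ x : ℝ) (ρ : ℂ) : ℂ :=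
  (1 + ρ) ^ (2 * b - 1 : ℂ) * (1 - ρ) ^ (-(2 * b + 1 + 2 * κ) : ℂ) *
    (1 + 2 * x * ρ + ρ ^ 2) ^ (κ : ℂ)

theorem exists_norm_eq_one_re_eq (hx : |x| ≤ 1) : ∃ u : ℂ, ‖u‖ = 1 ∧ u.re = x :=
  ⟨Complex.exp (Real.arccos x * Complex.I), Complex.norm_exp_ofReal_mul_I _, by
    rw [Complex.exp_ofReal_mul_I_re, Real.cos_arccos (abs_le.1 hx).1 (abs_le.1 hx).2]⟩

theorem add_conj_eq_two_mul_re (u : ℂ) : u + conj u = 2 * u.re := by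
  rw [Complex.add_conj, Complex.ofReal_mul, Complex.ofReal_ofNat]

theorem mul_conj_eq_one (hu : ‖u‖ = 1) : u * conj u = 1 := by
  rw [Complex.mul_conj', hu, Complex.ofReal_one, one_pow]

theorem one_add_mul_mul_one_add_conj_mul (hu : ‖u‖ = 1) (z : ℂ) :
    (1 + u * z) * (1 + conj u * z) = 1 + 2 * u.re * z + z ^ 2 := by
  linear_combination z * add_conj_eq_two_mul_re u + z ^ 2 * mul_conj_eq_one hu

theorem norm_mul_lt_one (hu : ‖u‖ = 1) (hz : ‖z‖ < 1) : ‖u * z‖ < 1 := by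
  rwa [norm_mul, hu, one_mul]

theorem re_one_add_pos (hz : ‖z‖ < 1) : 0 < (1 + z).re := by
  have := (abs_le.1 (Complex.abs_re_le_norm z)).1
  rw [Complex.add_re, Complex.one_re]
  linarith

theorem one_add_two_mul_add_sq_mem_slitPlane (hx : |x| ≤ 1) (hz : ‖z‖ < 1) :
    1 + 2 * x * z + z ^ 2 ∈ Complex.slitPlane := by
  obtain ⟨u, hu, rfl⟩ := exists_norm_eq_one_re_eq hx
  rw [← one_add_mul_mul_one_add_conj_mul hu]
  exact mul_mem_slitPlane_of_re_pos (re_one_add_pos (norm_mul_lt_one hu hz))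
    (re_one_add_pos (norm_mul_lt_one (by rwa [Complex.norm_conj]) hz))

/-- The logarithmic derivative `u / (1 + u z)` of `1 + u z`. -/
noncomputable def linearLogDeriv (u z : ℂ) : ℂ := u * (1 + u * z)⁻¹

/-- The logarithmic derivative of `radialKernel b κ u.re` for a unit complex number `u`. -/
noncomputable def radialLogDeriv (b κ : ℝ) (u z : ℂ) : ℂ :=
  (2 * b - 1) * linearLogDeriv 1 z + -(2 * b + 1 + 2 * κ) * linearLogDeriv (-1) z +
    κ * (linearLogDeriv u z + linearLogDeriv (conj u) z)

theorem analyticAt_linearLogDeriv (u : ℂ) : AnalyticAt ℂ (linearLogDeriv u) 0 :=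
  analyticAt_const.mul ((by fun_prop : AnalyticAt ℂ (fun z => 1 + u * z) 0).inv (by simp))

theorem analyticAt_radialLogDeriv (b κ : ℝ) (u : ℂ) : AnalyticAt ℂ (radialLogDeriv b κ u) 0 :=
  ((analyticAt_const.mul (analyticAt_linearLogDeriv 1)).add
    (analyticAt_const.mul (analyticAt_linearLogDeriv (-1)))).add
      (analyticAt_const.mul ((analyticAt_linearLogDeriv u).add (analyticAt_linearLogDeriv _)))

theorem iteratedDeriv_linearLogDeriv_zero (u : ℂ) (n : ℕ) :
    iteratedDeriv n (linearLogDeriv u) 0 = (-1) ^ n * n.factorial * u ^ (n + 1) := by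
  have h : linearLogDeriv u = fun z => u * (u * z + 1)⁻¹ := by
    funext z
    rw [linearLogDeriv, add_comm]
  rw [h, iteratedDeriv_const_mul_field, iteratedDeriv_eq_iterate, iter_deriv_inv_linear]
  simp only [mul_zero, zero_add, one_zpow, mul_one]
  ring

theorem iteratedDeriv_radialLogDeriv_zero (b κ : ℝ) (u : ℂ) (n : ℕ) :
    iteratedDeriv n (radialLogDeriv b κ u) 0 = (n.factorial * ((2 * b - 1) * (-1) ^ n +
      (2 * b + 1 + 2 * κ) + 2 * κ * ((-1) ^ n * (u ^ (n + 1)).re)) : ℝ) := by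
  have h (v : ℂ) := (analyticAt_linearLogDeriv v).contDiffAt (n := n)
  have hsign : (-1 : ℂ) ^ n * (-1) ^ (n + 1) = -1 := by
    rw [pow_succ, ← mul_assoc, ← mul_pow, neg_mul_neg, one_mul, one_pow, one_mul]
  have hre := add_conj_eq_two_mul_re (u ^ (n + 1))
  rw [map_pow] at hre
  unfold radialLogDeriv
  rw [iteratedDeriv_fun_add ((contDiffAt_const.mul (h 1)).add (contDiffAt_const.mul (h (-1))))
      (contDiffAt_const.mul ((h u).add (h _))),
    iteratedDeriv_fun_add (contDiffAt_const.mul (h 1)) (contDiffAt_const.mul (h (-1)))]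
  simp only [iteratedDeriv_const_mul_field]
  rw [iteratedDeriv_fun_add (h u) (h _)]
  simp only [iteratedDeriv_linearLogDeriv_zero]
  push_cast
  linear_combination κ * (-1) ^ n * n.factorial * hre -
    n.factorial * (2 * b + 1 + 2 * κ) * hsign

theorem hasDerivAt_cpow_const_of_mem_slitPlane {f : ℂ → ℂ} {f' : ℂ} (e : ℂ)
    (hf : HasDerivAt f f' z) (hz : f z ∈ Complex.slitPlane) :
    HasDerivAt (fun w => f w ^ e) (e * (f' / f z) * f z ^ e) z := by
  refine (hf.cpow_const (c := e) hz).congr_deriv ?_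
  rw [Complex.cpow_sub _ _ (Complex.slitPlane_ne_zero hz), Complex.cpow_one]
  ring

theorem hasDerivAt_radialKernel (b κ : ℝ) (hu : ‖u‖ = 1) (hz : ‖z‖ < 1) :
    HasDerivAt (radialKernel b κ u.re) (radialLogDeriv b κ u z * radialKernel b κ u.re z) z := by
  have hu₁ := one_add_ne_zero_of_norm_lt_one (norm_mul_lt_one hu hz)
  have hu₂ := one_add_ne_zero_of_norm_lt_one
    (norm_mul_lt_one ((Complex.norm_conj u).trans hu) hz)
  have hlog : (2 * u.re + 2 * z) / (1 + 2 * u.re * z + z ^ 2)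
      = linearLogDeriv u z + linearLogDeriv (conj u) z := by
    rw [← one_add_mul_mul_one_add_conj_mul hu z, ← add_conj_eq_two_mul_re u, linearLogDeriv,
      linearLogDeriv]
    field_simp
    linear_combination -2 * z * mul_conj_eq_one hu
  have hplus := hasDerivAt_cpow_const_of_mem_slitPlane (2 * b - 1)
    ((hasDerivAt_id' z).const_add 1) (Complex.mem_slitPlane_of_norm_lt_one hz)
  have hminus := hasDerivAt_cpow_const_of_mem_slitPlane (-(2 * b + 1 + 2 * κ))
    ((hasDerivAt_id' z).const_sub 1) (one_sub_mem_slitPlane_of_norm_lt_one hz)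
  have hmiddle := hasDerivAt_cpow_const_of_mem_slitPlane κ
    ((((hasDerivAt_id' z).const_mul (2 * (u.re : ℂ))).const_add 1).fun_add (hasDerivAt_pow 2 z))
    (one_add_two_mul_add_sq_mem_slitPlane (hu ▸ Complex.abs_re_le_norm u) hz)
  refine ((hplus.mul hminus).mul hmiddle).congr_deriv ?_
  simp only [mul_one, Nat.cast_ofNat, Nat.add_one_sub_one, pow_one, hlog, Pi.mul_apply]
  simp only [radialKernel, radialLogDeriv, linearLogDeriv, one_mul, neg_one_mul, ← sub_eq_add_neg]
  ring

theorem radialLogDeriv_coeff_nonneg {e r : ℝ} (hb : 0 ≤ b) (hκ : -1 / 2 ≤ κ) (hbκ : 0 ≤ b + κ)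
    (he : e = 1 ∨ e = -1) (hr : |r| ≤ 1) :
    0 ≤ (2 * b - 1) * e + (2 * b + 1 + 2 * κ) + 2 * κ * (e * r) := by
  obtain ⟨hr₁, hr₂⟩ := abs_le.1 hr
  rcases he with rfl | rfl <;> rcases le_total 0 κ <;> nlinarith

theorem hasNonnegTaylor_radialLogDeriv (hb : 0 ≤ b) (hκ : -1 / 2 ≤ κ) (hbκ : 0 ≤ b + κ)
    (hu : ‖u‖ = 1) : HasNonnegTaylor (radialLogDeriv b κ u) := by
  refine ⟨analyticAt_radialLogDeriv b κ u, fun n => ?_⟩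
  have hr : |(u ^ (n + 1)).re| ≤ 1 :=
    (Complex.abs_re_le_norm _).trans (by rw [norm_pow, hu, one_pow])
  rw [iteratedDeriv_radialLogDeriv_zero]
  exact_mod_cast mul_nonneg (Nat.cast_nonneg _)
    (radialLogDeriv_coeff_nonneg hb hκ hbκ (neg_one_pow_eq_or ℝ n) hr)

theorem radialLogDeriv_zero (b κ : ℝ) (u : ℂ) :
    radialLogDeriv b κ u 0 = (4 * b + 2 * κ * (1 + u.re) : ℝ) := by
  simp only [radialLogDeriv, linearLogDeriv, mul_zero, add_zero, inv_one, mul_one,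
    add_conj_eq_two_mul_re]
  push_cast
  ring

theorem radialLogDeriv_zero_pos (hb : 0 < b) (hbκ : 0 ≤ b + κ) (hu : ‖u‖ = 1) (hu1 : u.re < 1) :
    0 < radialLogDeriv b κ u 0 := by
  have hr := (abs_le.1 (hu ▸ Complex.abs_re_le_norm u)).1
  rw [radialLogDeriv_zero, Complex.zero_lt_real]
  rcases le_or_gt 0 κ <;> nlinarith

theorem differentiableOn_radialKernel (b κ : ℝ) (hx : |x| ≤ 1) :
    DifferentiableOn ℂ (radialKernel b κ x) (ball 0 1) := by
  obtain ⟨u, hu, rfl⟩ := exists_norm_eq_one_re_eq hx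
  exact fun z hz => (hasDerivAt_radialKernel b κ hu
    (mem_ball_zero_iff.1 hz)).differentiableAt.differentiableWithinAt

theorem iteratedDeriv_radialKernel_pos (hb : 0 < b) (hκ : -1 / 2 ≤ κ) (hbκ : 0 ≤ b + κ)
    (hx : |x| ≤ 1) (hx1 : x < 1) (n : ℕ) : 0 < iteratedDeriv n (radialKernel b κ x) 0 := by
  have hK := (differentiableOn_radialKernel b κ hx).analyticAt (ball_mem_nhds 0 one_pos)
  obtain ⟨u, hu, rfl⟩ := exists_norm_eq_one_re_eq hx
  refine iteratedDeriv_pos_of_deriv_eq_mul hK (hasNonnegTaylor_radialLogDeriv hb.le hκ hbκ hu) ?_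
    (by simp [radialKernel]) (radialLogDeriv_zero_pos hb hbκ hu hx1) n
  filter_upwards [ball_mem_nhds 0 one_pos] with z hz
    using (hasDerivAt_radialKernel b κ hu (mem_ball_zero_iff.1 hz)).deriv

end RadialKernel

section ComplementarySeries

variable {a b c p q s ρ : ℝ}

theorem ofReal_sq_cpow {x : ℝ} (hx : 0 < x) (e : ℂ) :
    ((x ^ 2 : ℝ) : ℂ) ^ e = (x : ℂ) ^ (2 * e) := by
  rw [ofReal_cpow_eq_exp (pow_pos hx 2), ofReal_cpow_eq_exp hx, Real.log_pow]
  congr 1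
  push_cast
  ring

theorem eulerIntegral_koebe_eq_integral_quadratic (a p q : ℂ) (hρ : ρ ∈ Set.Ioo (0 : ℝ) 1) :
    eulerIntegral a p q (koebe ρ) = (1 + ρ : ℂ) ^ (2 * p) * (1 - ρ : ℂ) ^ (2 * (q - a)) *
      ∫ s in Set.Ioo (0 : ℝ) 1, betaWeight p q s *
        (1 + 2 * (2 * s - 1 : ℝ) * ρ + ρ ^ 2 : ℂ) ^ (a - (p + q)) := by
  have hA : 0 < 1 + ρ := by linarith [hρ.1]
  have hB : 0 < 1 - ρ := sub_pos.2 hρ.2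
  have hX (s : ℝ) : (1 - s) * (1 + ρ) ^ 2 + s * (1 - ρ) ^ 2
      = (1 + ρ) ^ 2 * (1 - s) * 1 + (1 - ρ) ^ 2 * s * 1 := by
    ring
  have hquad (s : ℝ) : (((1 - s) * (1 - ρ) ^ 2 + s * (1 + ρ) ^ 2 : ℝ) : ℂ)
      = 1 + 2 * (2 * s - 1 : ℝ) * ρ + ρ ^ 2 := by
    push_cast
    ring
  simp only [eulerIntegral_koebe a p q hρ, hX]
  rw [integral_betaWeight_mul_cpow_rescale a p q (pow_pos hA 2) (pow_pos hB 2) one_pos one_pos]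
  simp only [hquad, mul_one, sub_add_cancel, Complex.ofReal_one, Complex.one_cpow]
  rw [ofReal_sq_cpow hA, ofReal_sq_cpow hB, ← mul_assoc, ← mul_assoc,
    ← Complex.cpow_add _ _ (by exact_mod_cast hA.ne'), ← mul_add, add_sub_cancel,
    Complex.ofReal_add, Complex.ofReal_sub, Complex.ofReal_one]

theorem eulerIntegral_koebe_mul_deriv_koebe (a b c : ℝ) (hρ : ρ ∈ Set.Ioo (0 : ℝ) 1) :
    eulerIntegral (a + 1) (b + 1) (c - b) (koebe ρ) * (4 * (1 - ρ) / (1 + ρ) ^ 3)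
      = 4 * ∫ s in Set.Ioo (0 : ℝ) 1,
        betaWeight (b + 1) (c - b) s * radialKernel b (a - c) (2 * s - 1) ρ := by
  have hA : (1 + ρ : ℂ) ≠ 0 := by exact_mod_cast (by linarith [hρ.1] : 1 + ρ ≠ 0)
  have hB : (1 - ρ : ℂ) ≠ 0 := by exact_mod_cast (sub_pos.2 hρ.2).ne'
  have hplus : (1 + ρ : ℂ) ^ (2 * (b + 1) : ℂ) = (1 + ρ) ^ (2 * b - 1 : ℂ) * (1 + ρ) ^ 3 := by
    rw [← Complex.cpow_natCast, ← Complex.cpow_add _ _ hA]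
    congr 1
    push_cast
    ring
  have hminus : (1 - ρ : ℂ) ^ (-(2 * b + 1 + 2 * (a - c : ℝ)) : ℂ)
      = (1 - ρ) ^ (2 * (c - b - (a + 1)) : ℂ) * (1 - ρ) := by
    nth_rw 3 [← Complex.cpow_one (1 - ρ : ℂ)]
    rw [← Complex.cpow_add _ _ hB]
    congr 1
    push_cast
    ring
  have hexp : (a + 1 - (b + 1 + (c - b)) : ℂ) = (a - c : ℝ) := by
    push_cast
    ring
  simp only [eulerIntegral_koebe_eq_integral_quadratic _ _ _ hρ, hexp, radialKernel, hminus, hplus]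
  rw [div_eq_mul_inv, mul_mul_mul_comm]
  simp only [mul_left_comm (betaWeight _ _ _), integral_const_mul]
  field_simp

theorem betaWeight_ofReal_pos (p q : ℝ) (hs : s ∈ Set.Ioo (0 : ℝ) 1) : 0 < betaWeight p q s := by
  have h : betaWeight p q s = (s ^ (p - 1) * (1 - s) ^ (q - 1) : ℝ) := by
    rw [betaWeight, Complex.ofReal_mul, Complex.ofReal_cpow hs.1.le,
      Complex.ofReal_cpow (sub_pos.2 hs.2).le]
    push_cast
    rfl
  rw [h, Complex.zero_lt_real]
  exact mul_pos (Real.rpow_pos_of_pos hs.1 _) (Real.rpow_pos_of_pos (sub_pos.2 hs.2) _)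

theorem setIntegral_pos_of_forall_pos {α : Type*} [MeasurableSpace α] {μ : Measure α} {S : Set α}
    {f : α → ℂ} (hS : MeasurableSet S) (hμS : 0 < μ S) (hf : IntegrableOn f S μ)
    (hpos : ∀ s ∈ S, 0 < f s) : 0 < ∫ s in S, f s ∂μ := by
  have hre (s : α) (hs : s ∈ S) := Complex.pos_iff.1 (hpos s hs)
  have hof : ∫ s in S, f s ∂μ = (∫ s in S, (f s).re ∂μ : ℝ) := by
    rw [← integral_complex_ofReal]
    exact setIntegral_congr_fun hS fun s hs => Complex.ext rfl (hre s hs).2.symm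
  rw [hof, Complex.zero_lt_real, setIntegral_pos_iff_support_of_nonneg_ae
    ((ae_restrict_mem hS).mono fun s hs => (hre s hs).1.le) hf.re]
  exact hμS.trans_le (measure_mono fun s hs => ⟨(hre s hs).1.ne', hs⟩)

theorem abs_two_mul_sub_one_le_one (hs : s ∈ Set.Icc (0 : ℝ) 1) : |2 * s - 1| ≤ 1 :=
  abs_le.2 ⟨by linarith [hs.1], by linarith [hs.2]⟩

theorem isDominatedHolomorphic_betaWeight_mul_radialKernel (b κ : ℝ) (hp : 0 < p) (hq : 0 < q) :
    IsDominatedHolomorphic (volume.restrict (Set.Ioo (0 : ℝ) 1))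
      (fun s z => betaWeight p q s * radialKernel b κ (2 * s - 1) z) (ball 0 1) := by
  refine isDominatedHolomorphic_betaWeight_mul isOpen_ball hp hq ?_ fun s hs =>
    differentiableOn_radialKernel b κ (abs_two_mul_sub_one_le_one (Set.Ioo_subset_Icc_self hs))
  have hnorm {x : ℝ × ℂ} (hx : x ∈ Set.Icc (0 : ℝ) 1 ×ˢ ball (0 : ℂ) 1) := mem_ball_zero_iff.1 hx.2
  exact ContinuousOn.mul (ContinuousOn.mul (ContinuousOn.cpow_const (by fun_prop) fun x hx =>
    Complex.mem_slitPlane_of_norm_lt_one (hnorm hx)) (ContinuousOn.cpow_const (by fun_prop)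
      fun x hx => one_sub_mem_slitPlane_of_norm_lt_one (hnorm hx)))
    (ContinuousOn.cpow_const (by fun_prop) fun x hx =>
      one_add_two_mul_add_sq_mem_slitPlane (abs_two_mul_sub_one_le_one hx.1) (hnorm hx))

theorem iteratedDeriv_integral_radialKernel_pos {κ : ℝ} (hp : 0 < p) (hq : 0 < q) (hb : 0 < b)
    (hκ : -1 / 2 ≤ κ) (hbκ : 0 ≤ b + κ) (n : ℕ) :
    0 < iteratedDeriv n (fun z => ∫ s in Set.Ioo (0 : ℝ) 1,
      betaWeight p q s * radialKernel b κ (2 * s - 1) z) 0 := by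
  have hdom := isDominatedHolomorphic_betaWeight_mul_radialKernel b κ hp hq
  have h0 : (0 : ℂ) ∈ ball (0 : ℂ) 1 := mem_ball_self one_pos
  rw [hdom.iteratedDeriv_integral h0]
  refine setIntegral_pos_of_forall_pos measurableSet_Ioo (by simp)
    ((hdom.iteratedDeriv_family n).integrable h0) fun s hs => ?_
  rw [iteratedDeriv_const_mul_field]
  exact mul_pos (betaWeight_ofReal_pos p q hs) (iteratedDeriv_radialKernel_pos hb hκ hbκ
    (abs_two_mul_sub_one_le_one (Set.Ioo_subset_Icc_self hs)) (by linarith [hs.2]) n)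

theorem hasDerivAt_regularizedF (a : ℂ) {b c z : ℂ} (hb : 0 < b.re) (hc : 0 < (c - b).re)
    (hz : z ∈ cutPlane) :
    HasDerivAt (regularizedF a b c) ((Complex.Gamma b * Complex.Gamma (c - b))⁻¹ *
      (a * eulerIntegral (a + 1) (b + 1) (c - b) z)) z :=
  ((hasDerivAt_eulerIntegral a hb hc hz).const_mul _).congr_of_eventuallyEq <| by
    filter_upwards [isOpen_cutPlane.mem_nhds hz] with w hw
      using regularizedF_eq_eulerIntegral a hb hc hw

theorem deriv_regularizedF_koebe_eventuallyEq (a : ℝ) (hb : 0 < b) (hbc : b < c) :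
    deriv (fun ρ => regularizedF a b c (koebe ρ)) =ᶠ[𝓝 0] fun ρ =>
      (4 * a / (Real.Gamma b * Real.Gamma (c - b)) : ℝ) * ∫ s in Set.Ioo (0 : ℝ) 1,
        betaWeight (b + 1 : ℝ) (c - b : ℝ) s * radialKernel b (a - c) (2 * s - 1) ρ := by
  have hb' : 0 < (b : ℂ).re := hb
  have hc' : 0 < (c - b : ℂ).re := by simpa using hbc
  have hd : AnalyticAt ℂ (deriv fun ρ => regularizedF a b c (koebe ρ)) 0 :=
    ((differentiableOn_comp_koebe (differentiableOn_regularizedF a hb' hc')).analyticAt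
      (ball_mem_nhds 0 one_pos)).deriv
  have hI := (isDominatedHolomorphic_betaWeight_mul_radialKernel b (a - c) (add_pos hb one_pos)
    (sub_pos.2 hbc)).differentiableOn_integral.analyticAt (ball_mem_nhds 0 one_pos)
  refine eventuallyEq_of_eqOn_Ioo hd (analyticAt_const.fun_mul hI) fun ρ hρ => ?_
  have hnorm := norm_ofReal_lt_one_of_mem_Ioo hρ
  have hderiv := (hasDerivAt_regularizedF a hb' hc' (koebe_mem_cutPlane hnorm)).comp (ρ : ℂ)
    (hasDerivAt_koebe hnorm)
  refine hderiv.deriv.trans ?_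
  have hmul := eulerIntegral_koebe_mul_deriv_koebe a b c hρ
  push_cast [← Complex.Gamma_ofReal]
  linear_combination (Complex.Gamma b * Complex.Gamma (c - b))⁻¹ * a * hmul

theorem regularizedF_zero (a b c : ℂ) : regularizedF a b c 0 = (Complex.Gamma c)⁻¹ := by
  rw [regularizedF_eq_of_norm_lt_one a b c (by simp)]
  refine (hasSum_regularizedGaussHGFun a b c (by simp)).unique ?_
  convert! hasSum_ite_eq 0 (Complex.Gamma c)⁻¹ using 2 with n
  rcases eq_or_ne n 0 with rfl | hn <;> simp [*]

theorem iteratedDeriv_regularizedF_koebe_pos (ha : 0 < a) (hb : 0 < b) (hbc : b < c)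
    (hca : c ≤ a + 1 / 2) (hcab : c ≤ a + b) (n : ℕ) :
    0 < iteratedDeriv n (fun ρ => regularizedF a b c (koebe ρ)) 0 := by
  cases n with
  | zero =>
    rw [iteratedDeriv_zero, koebe_zero, regularizedF_zero, Complex.Gamma_ofReal]
    exact_mod_cast inv_pos.2 (Real.Gamma_pos_of_pos (hb.trans hbc))
  | succ n =>
    rw [iteratedDeriv_succ', (deriv_regularizedF_koebe_eventuallyEq a hb hbc).iteratedDeriv_eq,
      iteratedDeriv_const_mul_field]
    have hΓ := mul_pos (Real.Gamma_pos_of_pos hb) (Real.Gamma_pos_of_pos (sub_pos.2 hbc))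
    exact mul_pos (Complex.zero_lt_real.2 (div_pos (mul_pos four_pos ha) hΓ))
      (iteratedDeriv_integral_radialKernel_pos (add_pos hb one_pos) (sub_pos.2 hbc) hb
        (by linarith) (by linarith) n)

end ComplementarySeries

section Propagator

variable {d n : ℕ} {F : ℂ → ℂ} {lam : ℂ}

/-- The propagator with its parameters `d / 2 ± iλ` renamed `a` and `b`, as a function of the
hypergeometric variable `z = (1 + σ) / 2`. -/
noncomputable def propagatorKernel (d : ℕ) (a b z : ℂ) : ℂ :=
  Complex.Gamma a * Complex.Gamma b / (((4 * Real.pi) ^ (((d : ℝ) + 1) / 2) : ℝ) : ℂ) *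
    regularizedF a b ((d + 1) / 2) z

theorem propagatorKernel_comm (d : ℕ) (a b : ℂ) :
    propagatorKernel d a b = propagatorKernel d b a := by
  funext z
  rw [propagatorKernel, propagatorKernel, regularizedF_comm, mul_comm (Complex.Gamma a)]

theorem IsPrincipal.exists_freePropagator_eq (h : IsPrincipal lam) (d : ℕ) :
    ∃ a : ℂ, 2 * a.re = d ∧
      freePropagator d lam = fun σ => propagatorKernel d a (conj a) ((1 + σ) / 2) := by
  obtain ⟨x, rfl⟩ := h
  have hconj : conj (d / 2 + Complex.I * x) = (d / 2 - Complex.I * x : ℂ) := by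
    simp [sub_eq_add_neg, map_ofNat]
  refine ⟨d / 2 + Complex.I * x, by simp [mul_div_cancel₀], ?_⟩
  rw [hconj]
  rfl

theorem IsComplementary.exists_freePropagator_eq (h : IsComplementary d lam) :
    ∃ a b : ℝ, 0 < b ∧ b ≤ a ∧ a + b = d ∧
      freePropagator d lam = fun σ => propagatorKernel d a b ((1 + σ) / 2) := by
  obtain ⟨x, hx, hIx⟩ := h
  have habs : |x| < d / 2 := abs_lt.2 ⟨by linarith [hx.1], hx.2⟩
  refine ⟨d / 2 + |x|, d / 2 - |x|, by linarith, by linarith [abs_nonneg x], by ring, ?_⟩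
  have hG : freePropagator d lam
      = fun σ => propagatorKernel d (d / 2 + x : ℝ) (d / 2 - x : ℝ) ((1 + σ) / 2) := by
    funext σ
    rw [freePropagator, propagatorKernel, hIx]
    push_cast
    rfl
  rcases abs_choice x with hax | hax
  · rw [hG, hax]
  · rw [hG, hax, propagatorKernel_comm, sub_neg_eq_add, ← sub_eq_add_neg]

theorem differentiableOn_propagatorKernel (a : ℂ) {b : ℂ} (hb : 0 < b.re)
    (hbd : b.re < (d + 1) / 2) : DifferentiableOn ℂ (propagatorKernel d a b) cutPlane := by
  refine (differentiableOn_regularizedF a hb ?_).const_mul _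
  simpa using hbd

theorem hasNonnegTaylor_propagatorKernel_koebe (hd : 1 ≤ d) {a : ℂ} (ha : 2 * a.re = d) :
    HasNonnegTaylor fun ρ => propagatorKernel d a (conj a) (koebe ρ) := by
  have hd' : (1 : ℝ) ≤ d := by exact_mod_cast hd
  have h := hasNonnegTaylor_regularizedF_koebe_of_conj (c := (d + 1) / 2) ha (by linarith)
    (by linarith)
  push_cast at h
  refine ⟨analyticAt_const.mul h.analyticAt, fun n => ?_⟩
  simp only [propagatorKernel]
  rw [iteratedDeriv_const_mul_field, Complex.Gamma_conj, Complex.mul_conj]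
  refine mul_nonneg (div_nonneg ?_ ?_) (h.iteratedDeriv_nonneg n)
  · exact Complex.zero_le_real.2 (Complex.normSq_nonneg _)
  · exact Complex.zero_le_real.2 (by positivity)

theorem iteratedDeriv_propagatorKernel_koebe_pos (hd : 1 ≤ d) {a b : ℝ} (hb : 0 < b) (hba : b ≤ a)
    (hab : a + b = d) (n : ℕ) :
    0 < iteratedDeriv n (fun ρ => propagatorKernel d a b (koebe ρ)) 0 := by
  have hd' : (1 : ℝ) ≤ d := by exact_mod_cast hd
  have ha : 0 < a := hb.trans_le hba
  have h := iteratedDeriv_regularizedF_koebe_pos (c := (d + 1) / 2) ha hb (by linarith)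
    (by linarith) (by linarith) n
  push_cast at h
  simp only [propagatorKernel]
  rw [iteratedDeriv_const_mul_field, Complex.Gamma_ofReal, Complex.Gamma_ofReal]
  refine mul_pos (div_pos (mul_pos ?_ ?_) ?_) h
  · exact Complex.zero_lt_real.2 (Real.Gamma_pos_of_pos ha)
  · exact Complex.zero_lt_real.2 (Real.Gamma_pos_of_pos hb)
  · exact Complex.zero_lt_real.2 (by positivity)

/-- The coefficient of `ρ ^ n` in the expansion of `F (4 ρ / (1 + ρ) ^ 2)`, for functions `F` all of
whose coefficients are real. -/
noncomputable def radialCoeff (F : ℂ → ℂ) (n : ℕ) : ℝ :=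
  (iteratedDeriv n (fun ρ => F (koebe ρ)) 0).re / n.factorial

theorem radialCoeff_nonneg (h : 0 ≤ iteratedDeriv n (fun ρ => F (koebe ρ)) 0) :
    0 ≤ radialCoeff F n :=
  div_nonneg (Complex.nonneg_iff.1 h).1 n.factorial.cast_nonneg

theorem radialCoeff_pos (h : 0 < iteratedDeriv n (fun ρ => F (koebe ρ)) 0) :
    0 < radialCoeff F n :=
  div_pos (Complex.pos_iff.1 h).1 (Nat.cast_pos.2 n.factorial_pos)

theorem hasSum_radialCoeff (hF : DifferentiableOn ℂ F cutPlane)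
    (h : ∀ n, 0 ≤ iteratedDeriv n (fun ρ => F (koebe ρ)) 0) {ρ : ℂ} (hρ : ‖ρ‖ < 1) :
    HasSum (fun n => (radialCoeff F n : ℂ) * ρ ^ n) (F (koebe ρ)) := by
  refine (Complex.hasSum_taylorSeries_on_ball (differentiableOn_comp_koebe hF)
    (mem_ball_zero_iff.2 hρ)).congr_fun fun n => ?_
  have hreal : ((iteratedDeriv n (fun ρ => F (koebe ρ)) 0).re : ℂ)
      = iteratedDeriv n (fun ρ => F (koebe ρ)) 0 :=
    Complex.ext rfl (Complex.nonneg_iff.1 (h n)).2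
  rw [radialCoeff, Complex.ofReal_div, hreal, sub_zero, smul_eq_mul, smul_eq_mul,
    Complex.ofReal_natCast]
  ring

theorem differentiableOn_comp_one_add_div_two (hF : DifferentiableOn ℂ F cutPlane) :
    DifferentiableOn ℂ (fun σ => F ((1 + σ) / 2)) {σ | (1 + σ) / 2 ∈ cutPlane} :=
  hF.comp (by fun_prop) fun _ hσ => hσ

theorem exists_freePropagator_eq (hd : 1 ≤ d) (hlam : IsPrincipal lam ∨ IsComplementary d lam) :
    ∃ F : ℂ → ℂ, DifferentiableOn ℂ F cutPlane ∧
      (∀ n, 0 ≤ iteratedDeriv n (fun ρ => F (koebe ρ)) 0) ∧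
      (IsComplementary d lam → ∀ n, 0 < iteratedDeriv n (fun ρ => F (koebe ρ)) 0) ∧
      freePropagator d lam = fun σ => F ((1 + σ) / 2) := by
  have hd' : (1 : ℝ) ≤ d := by exact_mod_cast hd
  by_cases hcomp : IsComplementary d lam
  · obtain ⟨a, b, hb, hba, hab, hG⟩ := hcomp.exists_freePropagator_eq
    have hpos := iteratedDeriv_propagatorKernel_koebe_pos hd hb hba hab
    refine ⟨propagatorKernel d a b, differentiableOn_propagatorKernel a hb ?_,
      fun n => (hpos n).le, fun _ => hpos, hG⟩
    rw [Complex.ofReal_re]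
    linarith
  · obtain ⟨a, ha, hG⟩ := (hlam.resolve_right hcomp).exists_freePropagator_eq d
    refine ⟨propagatorKernel d a (conj a), differentiableOn_propagatorKernel a ?_ ?_,
      (hasNonnegTaylor_propagatorKernel_koebe hd ha).iteratedDeriv_nonneg,
      fun h => absurd h hcomp, hG⟩ <;>
    · rw [Complex.conj_re]
      linarith

end Propagator

end DeSitter

theorem proposition1 (d : ℕ) (hd : 1 ≤ d) (lam : ℂ)
    (hlam : DeSitter.IsPrincipal lam ∨ DeSitter.IsComplementary d lam) :
    DifferentiableOn ℂ (DeSitter.freePropagator d lam)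
      {σ : ℂ | (1 + σ) / 2 ∈ DeSitter.cutPlane} ∧
    ∃ B : ℕ → ℝ,
      (∀ n, 0 ≤ B n) ∧
      (DeSitter.IsComplementary d lam → ∀ n, 0 < B n) ∧
      ∀ σ ρ : ℂ, ‖ρ‖ < 1 → (1 + σ) / 2 = 4 * ρ / (1 + ρ) ^ 2 →
        HasSum (fun n : ℕ => (B n : ℂ) * ρ ^ n) (DeSitter.freePropagator d lam σ) := by
  obtain ⟨F, hF, hnonneg, hpos, hG⟩ := DeSitter.exists_freePropagator_eq hd hlam
  rw [hG]
  refine ⟨DeSitter.differentiableOn_comp_one_add_div_two hF, DeSitter.radialCoeff F,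
    fun n => DeSitter.radialCoeff_nonneg (hnonneg n),
    fun hcomp n => DeSitter.radialCoeff_pos (hpos hcomp n), fun σ ρ hρ hσ => ?_⟩
  simp only [hσ]
  exact DeSitter.hasSum_radialCoeff hF hnonneg hρ
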